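/- Let $d\ge 0$ and let $\{|a_k\rangle|b_k\rangle\}_{k\in K}\subset\mathbb C^2\otimes\mathbb C^d$ be a finite globally orthogonal product set, i.e. $\|a_k\|=\|b_k\|=1$ and $\langle a_k|a_l\rangle\langle b_k|b_l\rangle=0$ for $k\ne l$. An LOSQC strategy (local operations and simultaneous quantum communication, all spaces finite-dimensional) consists of isometries $U:A\to A_0B_1$, $V:B\to B_0A_1$ and POVMs $\{\Pi_k\}_{k\in K}$ on $A_0A_1$, $\{\tau_k\}_{k\in K}$ on $B_0B_1$. The set is perfectly distinguishable by LOSQC if for some such strategy $\operatorname{Tr}[(\Pi_k\otimes\tau_k)(U\otimes V)\rho_k(U\otimes V)^\dagger]=1$ for every $k$, where $\rho_k=|a_k\rangle\langle a_k|\otimes|b_k\rangle\langle b_k|$. An LOSCC strategy (simultaneous classical communication) consists of instruments (finite families of completely positive maps with trace-preserving sum) $\{\mathcal A_x\}_x$ from $A$ to $A_0$ and $\{\mathcal B_y\}_y$ from $B$ to $B_0$, and, for all $x,y$, POVMs $\{\Pi_k^{xy}\}_{k}$ on $A_0$ and $\{\tau_k^{xy}\}_{k}$ on $B_0$. The set is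 perfectly distinguishable by LOSCC if for some such strategy $\sum_{x,y}\operatorname{Tr}[\Pi_k^{xy}\mathcal A_x(|a_k\rangle\langle a_k|)]\operatorname{Tr}[\tau_k^{xy}\mathcal B_y(|b_k\rangle\langle b_k|)]=1$ for every $k$. The orthogonality of an ensemble $\{\rho_{i|\theta}\}_{i,\theta}$ on $\mathbb C^d$ can be classically broadcast if there is an instrument $\{\mathcal E_x\}_x$ such that, with $\sigma_{i|\theta}=\sum_x\mathcal E_x(\rho_{i|\theta})\otimes|x\rangle\langle x|$, for every $\theta$ and all $i\ne j$ the first marginals of $\sigma_{i|\theta},\sigma_{j|\theta}$ are orthogonal and so are the second marginals (two states $\rho,\sigma$ are orthogonal if $\operatorname{Tr}[\rho\sigma]=0$). Theorem. The set $\{|a_k\rangle|b_k\rangle\}_k$ is perfectly distinguishable by LOSCC if and only if it is perfectly distinguishable by LOSQC. Moreover, if it is perfectly distinguishable by either, then there is an orthonormal basis $|0\rangle,|1\rangle$ of $\mathbb C^2$ such that, after moving scalar phases between the two factors of each element, the set consists of elements $$|0\rangle|s_{i|0}\rangle,\qquad |1\rangle|s_{i|1}\rangle,\qquad |\phi_i\rangle|t_i\rangle,$$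 where the $|\phi_i\rangle$ are arbitrary unit vectors, $\langle s_{i|\theta}|s_{j|\theta}\rangle=\delta_{ij}$ for each $\theta$, the orthogonality of the ensemble $\{|s_{i|\theta}\rangle\}_{i,\theta}$ can be classically broadcast, and each unit vector $|t_i\rangle$ is orthogonal to the Bob vector of every other element. Any of the three groups may be empty. -/

import Mathlib

open scoped Matrix Kronecker ComplexOrder

namespace LocalDiscrimination

/-! ## States, measurements, channels -/

/-- The ket `|a⟩|b⟩` in `ℂ^m ⊗ ℂ^d`, coordinates indexed by pairs. -/
noncomputable def prodKet {m d : ℕ} (a : EuclideanSpace ℂ (Fin m)) (b : EuclideanSpace ℂ (Fin d)) :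
    EuclideanSpace ℂ (Fin m × Fin d) :=
  WithLp.toLp 2 (fun p => a p.1 * b p.2)

/-- The operator `|v⟩⟨v|`, a density matrix when `v` is a unit vector. -/
def ketbra {n : Type*} (v : EuclideanSpace ℂ n) : Matrix n n ℂ :=
  Matrix.vecMulVec (fun i => v i) (fun i => star (v i))

/-- A globally orthogonal product set `{|a_k⟩|b_k⟩}_k` in `ℂ^m ⊗ ℂ^d`:
normalized product states that are pairwise orthogonal as global states. -/
structure IsGOP {K : Type*} {m d : ℕ} (a : K → EuclideanSpace ℂ (Fin m))
    (b : K → EuclideanSpace ℂ (Fin d)) : Prop where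
  norm_left : ∀ k, ‖a k‖ = 1
  norm_right : ∀ k, ‖b k‖ = 1
  orthogonal : ∀ k l, k ≠ l → inner ℂ (prodKet (a k) (b k)) (prodKet (a l) (b l)) = 0

/-- A positive operator-valued measure with outcomes in `K`. -/
structure IsPOVM {K n : Type*} [Fintype K] [Fintype n] [DecidableEq n]
    (P : K → Matrix n n ℂ) : Prop where
  posSemidef : ∀ k, (P k).PosSemidef
  sum_eq_one : ∑ k, P k = 1

/-- The ampliation `id_r ⊗ Φ`, acting blockwise on `r × r` block matrices. -/
def ampliation {m n : Type*} (r : ℕ) (Φ : Matrix m m ℂ →ₗ[ℂ] Matrix n n ℂ)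
    (M : Matrix (Fin r × m) (Fin r × m) ℂ) : Matrix (Fin r × n) (Fin r × n) ℂ :=
  Matrix.of fun p q => Φ (Matrix.of fun i j => M (p.1, i) (q.1, j)) p.2 q.2

/-- Complete positivity: every ampliation `id_r ⊗ Φ` preserves positive semidefiniteness. -/
def IsCompletelyPositive {m n : Type*} [Fintype m] [Fintype n]
    (Φ : Matrix m m ℂ →ₗ[ℂ] Matrix n n ℂ) : Prop :=
  ∀ (r : ℕ) (M : Matrix (Fin r × m) (Fin r × m) ℂ), M.PosSemidef → (ampliation r Φ M).PosSemidef

/-- A quantum instrument: a finite family of completely positive maps whose sum is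
trace preserving. -/
structure IsInstrument {X m n : Type*} [Fintype X] [Fintype m] [Fintype n]
    (𝒜 : X → Matrix m m ℂ →ₗ[ℂ] Matrix n n ℂ) : Prop where
  completelyPositive : ∀ x, IsCompletelyPositive (𝒜 x)
  tracePreserving : ∀ ρ : Matrix m m ℂ, (∑ x, 𝒜 x ρ).trace = ρ.trace

/-! ## Classical orthogonality broadcasting -/

/-- Partial trace over the second tensor factor. -/
def traceRight {m n : Type*} [Fintype n] (σ : Matrix (m × n) (m × n) ℂ) : Matrix m m ℂ :=
  Matrix.of fun i j => ∑ k, σ (i, k) (j, k)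

/-- Partial trace over the first tensor factor. -/
def traceLeft {m n : Type*} [Fintype m] (σ : Matrix (m × n) (m × n) ℂ) : Matrix n n ℂ :=
  Matrix.of fun i j => ∑ k, σ (k, i) (k, j)

/-- Orthogonality of two density matrices. -/
def OrthogonalStates {n : Type*} [Fintype n] (ρ σ : Matrix n n ℂ) : Prop :=
  (ρ * σ).trace = 0

/-- The map `ρ ↦ ∑ x, 𝒜 x ρ ⊗ |x⟩⟨x|`, whose second output is a classical register. -/
def qcMap {X m n : Type*} [Fintype X] [DecidableEq X]
    (𝒜 : X → Matrix m m ℂ →ₗ[ℂ] Matrix n n ℂ) (ρ : Matrix m m ℂ) :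
    Matrix (n × X) (n × X) ℂ :=
  ∑ x, 𝒜 x ρ ⊗ₖ Matrix.single x x (1 : ℂ)

/-- The orthogonality of the ensemble `{ρ_{i|θ}}` can be classically broadcast: some channel with
a quantum output and a classical output makes, for each `θ`, the states with distinct `i`
orthogonal in both marginals. -/
def ClassicallyBroadcastable {Θ : Type*} {I : Θ → Type*} {d : ℕ}
    (ρ : ∀ θ, I θ → Matrix (Fin d) (Fin d) ℂ) : Prop :=
  ∃ (n N : ℕ) (𝒜 : Fin N → Matrix (Fin d) (Fin d) ℂ →ₗ[ℂ] Matrix (Fin n) (Fin n) ℂ),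
    IsInstrument 𝒜 ∧
    ∀ θ (i j : I θ), i ≠ j →
      OrthogonalStates (traceRight (qcMap 𝒜 (ρ θ i))) (traceRight (qcMap 𝒜 (ρ θ j))) ∧
      OrthogonalStates (traceLeft (qcMap 𝒜 (ρ θ i))) (traceLeft (qcMap 𝒜 (ρ θ j)))

/-! ## Local operations and simultaneous quantum communication -/

/-- An LOSQC strategy: Alice applies an isometry `U : A → A₀ B₁` and sends `B₁` to Bob, Bob applies
an isometry `V : B → B₀ A₁` and sends `A₁` to Alice; then Alice measures `A₀ A₁` and Bob
measures `B₀ B₁`. -/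
structure LOSQCStrategy (K : Type*) [Fintype K] (m d : ℕ) where
  (dimA₀ dimA₁ dimB₀ dimB₁ : ℕ)
  U : Matrix (Fin dimA₀ × Fin dimB₁) (Fin m) ℂ
  V : Matrix (Fin dimB₀ × Fin dimA₁) (Fin d) ℂ
  U_isometry : Uᴴ * U = 1
  V_isometry : Vᴴ * V = 1
  povmA : K → Matrix (Fin dimA₀ × Fin dimA₁) (Fin dimA₀ × Fin dimA₁) ℂ
  povmB : K → Matrix (Fin dimB₀ × Fin dimB₁) (Fin dimB₀ × Fin dimB₁) ℂ
  povmA_isPOVM : IsPOVM povmA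
  povmB_isPOVM : IsPOVM povmB

/-- The global state after communication, `(U ⊗ V) ρ (U ⊗ V)†`, with the tensor factors
`(A₀ B₁) (B₀ A₁)` rearranged as `(A₀ A₁) (B₀ B₁)`. -/
def LOSQCStrategy.finalState {K : Type*} [Fintype K] {m d : ℕ} (S : LOSQCStrategy K m d)
    (ρ : Matrix (Fin m × Fin d) (Fin m × Fin d) ℂ) :
    Matrix ((Fin S.dimA₀ × Fin S.dimA₁) × (Fin S.dimB₀ × Fin S.dimB₁))
      ((Fin S.dimA₀ × Fin S.dimA₁) × (Fin S.dimB₀ × Fin S.dimB₁)) ℂ :=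
  ((S.U ⊗ₖ S.V) * ρ * (S.U ⊗ₖ S.V)ᴴ).submatrix
    (fun p => ((p.1.1, p.2.2), (p.2.1, p.1.2))) (fun p => ((p.1.1, p.2.2), (p.2.1, p.1.2)))

/-- The probability that both parties output `k` on the input state `ρ`. -/
def LOSQCStrategy.successProb {K : Type*} [Fintype K] {m d : ℕ} (S : LOSQCStrategy K m d) (k : K)
    (ρ : Matrix (Fin m × Fin d) (Fin m × Fin d) ℂ) : ℂ :=
  ((S.povmA k ⊗ₖ S.povmB k) * S.finalState ρ).trace

/-- Some LOSQC strategy makes both parties identify every `k` with probability one. -/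
def LOSQCDistinguishable {K : Type*} [Fintype K] {m d : ℕ} (a : K → EuclideanSpace ℂ (Fin m))
    (b : K → EuclideanSpace ℂ (Fin d)) : Prop :=
  ∃ S : LOSQCStrategy K m d, ∀ k, S.successProb k (ketbra (prodKet (a k) (b k))) = 1

/-! ## Local operations and simultaneous classical communication -/

/-- An LOSCC strategy: Alice and Bob apply local instruments `𝒜`, `ℬ`, obtaining `x` and `y`, and
exchange the outcomes; then each measures the quantum output that they kept, with a measurement
that may depend on `x` and `y`. -/
structure LOSCCStrategy (K : Type*) [Fintype K] (m d : ℕ) where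
  (dimA₀ dimB₀ numX numY : ℕ)
  instrA : Fin numX → Matrix (Fin m) (Fin m) ℂ →ₗ[ℂ] Matrix (Fin dimA₀) (Fin dimA₀) ℂ
  instrB : Fin numY → Matrix (Fin d) (Fin d) ℂ →ₗ[ℂ] Matrix (Fin dimB₀) (Fin dimB₀) ℂ
  instrA_isInstrument : IsInstrument instrA
  instrB_isInstrument : IsInstrument instrB
  povmA : Fin numX → Fin numY → K → Matrix (Fin dimA₀) (Fin dimA₀) ℂ
  povmB : Fin numX → Fin numY → K → Matrix (Fin dimB₀) (Fin dimB₀) ℂ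
  povmA_isPOVM : ∀ x y, IsPOVM (povmA x y)
  povmB_isPOVM : ∀ x y, IsPOVM (povmB x y)

/-- The probability that both parties output `k` on the product input state `ρ ⊗ τ`. -/
def LOSCCStrategy.successProb {K : Type*} [Fintype K] {m d : ℕ} (S : LOSCCStrategy K m d) (k : K)
    (ρ : Matrix (Fin m) (Fin m) ℂ) (τ : Matrix (Fin d) (Fin d) ℂ) : ℂ :=
  ∑ x, ∑ y, ((S.povmA x y k ⊗ₖ S.povmB x y k) * (S.instrA x ρ ⊗ₖ S.instrB y τ)).trace

/-- Some LOSCC strategy makes both parties identify every `k` with probability one. -/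
def LOSCCDistinguishable {K : Type*} [Fintype K] {m d : ℕ} (a : K → EuclideanSpace ℂ (Fin m))
    (b : K → EuclideanSpace ℂ (Fin d)) : Prop :=
  ∃ S : LOSCCStrategy K m d, ∀ k, S.successProb k (ketbra (a k)) (ketbra (b k)) = 1

/-! ## The form of distinguishable sets -/

/-- The set `{|a_k⟩|b_k⟩}` has the form `|0⟩|s_{i|0}⟩, |1⟩|s_{i|1}⟩, |φ_i⟩|t_i⟩`, where
`|0⟩ = e 0`, `|1⟩ = e 1` is an orthonormal basis of Alice's qubit. The function `label` says which
of the three shapes the `k`-th element has (`some 0`, `some 1`, `none`), and `|α_k⟩|β_k⟩` is the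
same element with scalar phases moved between the factors: the `s_{i|θ}` are the `β k` with
label `some θ`, the `φ_i`, `t_i` are the `α k`, `β k` with label `none`. -/
def HasBroadcastForm {K : Type*} {d : ℕ} (a : K → EuclideanSpace ℂ (Fin 2))
    (b : K → EuclideanSpace ℂ (Fin d)) : Prop :=
  ∃ (e : OrthonormalBasis (Fin 2) ℂ (EuclideanSpace ℂ (Fin 2)))
    (α : K → EuclideanSpace ℂ (Fin 2)) (β : K → EuclideanSpace ℂ (Fin d))
    (label : K → Option (Fin 2)),
    (∀ k, ‖α k‖ = 1 ∧ ‖β k‖ = 1 ∧ prodKet (a k) (b k) = prodKet (α k) (β k)) ∧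
    (∀ k θ, label k = some θ → α k = e θ) ∧
    (∀ θ, Orthonormal ℂ (fun i : {k : K // label k = some θ} => β i)) ∧
    ClassicallyBroadcastable
      (fun (θ : Fin 2) (i : {k : K // label k = some θ}) => ketbra (β i)) ∧
    (∀ k, label k = none → ∀ l, l ≠ k → inner ℂ (β k) (β l) = 0)

end LocalDiscrimination

/-!
The proof goes in a circle: classical communication can be simulated by quantum communication,
discrimination by quantum communication forces the broadcast form, and the broadcast form can be
discriminated by classical communication.

`LOSCCDistinguishable.losqcDistinguishable`: each instrument is dilated to an isometry through its
Kraus operators; the outcome is copied, one copy is kept and the other is sent.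

`LOSQCDistinguishable.hasBroadcastForm`: write `A k`, `B k` for the outputs `U |a_k⟩`, `V |b_k⟩`, read
as matrices. The reduced state of each party before the final measurement is a product, so perfect
discrimination means (`LOSQCDistinguishable.exists_isometries`) that for `k ≠ l`
* `(A k)ᴴ * A l = 0` or `B l * (B k)ᴴ = 0`, and
* `A l * (A k)ᴴ = 0` or `(B k)ᴴ * B l = 0`.

Each of these four equations implies that the corresponding input vectors are orthogonal. If all of
Bob's vectors are orthogonal, every element is of the kind `|φ_i⟩|t_i⟩`. Otherwise some pair has
`⟨b_k|b_l⟩ ≠ 0`; then both alternatives about Alice hold for it, `a_k`, `a_l` form a basis `e` of the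
qubit, and `U` copies this basis. Hence Alice's alternatives hold only for pairs of kets proportional
to different vectors of `e`, and for every other pair both of Bob's alternatives hold
(`exists_basis_of_inner_ne_zero`). This gives the form, except that the two outputs of `V` are
quantum. As there are only two groups, `|0⟩|s_{i|0}⟩` and `|1⟩|s_{i|1}⟩`, one can measure the first
output of `V` to identify the members of the first group and the second output to identify those of
the second: the two measurements act on different factors, hence commute, and their joint outcome is
classical (`exists_broadcasting_measurement`, `ClassicallyBroadcastable.of_projectionFamily`).

`HasBroadcastForm.losccDistinguishable`: Bob measures the `|t_i⟩` and otherwise applies the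
broadcasting instrument, Alice measures in the basis `e`, and the two outcomes determine the element.
For an empty index set this strategy does not exist, and the implication is proved directly.
-/

namespace LocalDiscrimination

/-! ### Completely positive maps and Kraus operators -/

/-- The map `ρ ↦ L ρ Lᴴ`. -/
def conjMap {m n : Type*} [Fintype m] (L : Matrix n m ℂ) :
    Matrix m m ℂ →ₗ[ℂ] Matrix n n ℂ where
  toFun ρ := L * ρ * Lᴴ
  map_add' := by intro x y; simp [Matrix.mul_add, Matrix.add_mul]
  map_smul' := by intro c x; simp

theorem conjMap_apply {m n : Type*} [Fintype m] (L : Matrix n m ℂ) (ρ : Matrix m m ℂ) :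
    conjMap L ρ = L * ρ * Lᴴ := rfl

theorem isCompletelyPositive_conjMap {m n : Type*} [Fintype m] [Fintype n]
    (L : Matrix n m ℂ) : IsCompletelyPositive (conjMap L) := by
  classical
  intro r M hM
  have : ampliation r (conjMap L) M
      = ((1 : Matrix (Fin r) (Fin r) ℂ) ⊗ₖ L) * M * ((1 : Matrix (Fin r) (Fin r) ℂ) ⊗ₖ L)ᴴ := by
    ext ⟨i, p⟩ ⟨j, q⟩
    simp [ampliation, conjMap, Matrix.mul_apply, Fintype.sum_prod_type, Matrix.one_apply,
      Finset.sum_mul, ite_mul, apply_ite]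
  rw [this]
  exact hM.mul_mul_conjTranspose_same _

theorem IsCompletelyPositive.comp {m n l : Type*} [Fintype m] [Fintype n] [Fintype l]
    {Ψ : Matrix n n ℂ →ₗ[ℂ] Matrix l l ℂ} {Φ : Matrix m m ℂ →ₗ[ℂ] Matrix n n ℂ}
    (hΨ : IsCompletelyPositive Ψ) (hΦ : IsCompletelyPositive Φ) :
    IsCompletelyPositive (Ψ ∘ₗ Φ) :=
  fun r M hM => hΨ r _ (hΦ r M hM)

/-- A completely positive map sends positive semidefinite matrices to such matrices. -/
theorem IsCompletelyPositive.map_posSemidef {m n : Type*} [Fintype m] [Fintype n]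
    {Φ : Matrix m m ℂ →ₗ[ℂ] Matrix n n ℂ}
    (hΦ : IsCompletelyPositive Φ) {ρ : Matrix m m ℂ} (hρ : ρ.PosSemidef) :
    (Φ ρ).PosSemidef :=
  (hΦ 1 (ρ.submatrix Prod.snd Prod.snd) (hρ.submatrix _)).submatrix (fun i => ((0 : Fin 1), i))

open scoped MatrixOrder Matrix.Norms.L2Operator in
/-- Kraus decomposition: the Choi matrix is positive semidefinite, and the rows of a factor `B`
in `C = Bᴴ * B` are the Kraus operators. -/
theorem IsCompletelyPositive.exists_kraus {m : ℕ} {n : Type*} [Fintype n]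
    {Φ : Matrix (Fin m) (Fin m) ℂ →ₗ[ℂ] Matrix n n ℂ} (hΦ : IsCompletelyPositive Φ) :
    ∃ L : Fin m × n → Matrix n (Fin m) ℂ, ∀ ρ, Φ ρ = ∑ e, L e * ρ * (L e)ᴴ := by
  classical
  let v : Fin m × Fin m → ℂ := fun p => if p.1 = p.2 then 1 else 0
  have h := hΦ m (Matrix.vecMulVec v (star v)) (Matrix.posSemidef_vecMulVec_self_star v)
  obtain ⟨B, hB⟩ := CStarAlgebra.nonneg_iff_eq_star_mul_self.mp h.nonneg
  rw [Matrix.star_eq_conjTranspose] at hB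
  have key : ∀ i j p q, Φ (Matrix.single i j 1) p q = ∑ e, star (B e (i, p)) * B e (j, q) := by
    intro i j p q
    have h1 := congrFun (congrFun hB (i, p)) (j, q)
    rw [Matrix.mul_apply] at h1
    simp only [Matrix.conjTranspose_apply] at h1
    have h2 : (Matrix.of fun a b => Matrix.vecMulVec v (star v) (i, a) (j, b)) =
        Matrix.single i j (1 : ℂ) := by
      ext a b
      simp [v, Matrix.vecMulVec_apply, Matrix.single_apply, ← ite_and, and_comm]
    rw [← h1, ← h2]
    rfl
  refine ⟨fun e => Matrix.of fun p i => star (B e (i, p)), fun ρ => ?_⟩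
  conv_lhs => rw [Matrix.matrix_eq_sum_single ρ]
  ext p q
  have h2 : ∀ i j, Matrix.single i j (ρ i j) = ρ i j • Matrix.single i j (1 : ℂ) := by
    intro i j; simp
  simp only [h2, map_sum, map_smul, Matrix.sum_apply, Matrix.smul_apply, key, Matrix.mul_apply,
    Matrix.conjTranspose_apply, Matrix.of_apply, star_star, smul_eq_mul, Finset.sum_mul,
    Finset.mul_sum]
  rw [Finset.sum_comm]
  conv_rhs => rw [Finset.sum_comm]
  refine Finset.sum_congr rfl fun i _ => ?_
  conv_rhs => rw [Finset.sum_comm]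
  refine Finset.sum_congr rfl fun j _ => Finset.sum_congr rfl fun e _ => ?_
  ring

/-- Joint Kraus operators of an instrument satisfy the completeness relation. -/
theorem IsInstrument.exists_kraus {X : Type*} [Fintype X] {m : ℕ} {n : Type*} [Fintype n]
    {𝒜 : X → Matrix (Fin m) (Fin m) ℂ →ₗ[ℂ] Matrix n n ℂ} (h : IsInstrument 𝒜) :
    ∃ L : X → Fin m × n → Matrix n (Fin m) ℂ,
      (∀ x ρ, 𝒜 x ρ = ∑ e, L x e * ρ * (L x e)ᴴ) ∧ ∑ x, ∑ e, (L x e)ᴴ * L x e = 1 := by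
  choose L hL using fun x => (h.completelyPositive x).exists_kraus
  refine ⟨L, hL, Matrix.ext_iff_trace_mul_right.mpr fun ρ => ?_⟩
  have := h.tracePreserving ρ
  simp only [hL, Matrix.trace_sum] at this
  rw [one_mul, ← this]
  simp only [Matrix.sum_mul, Matrix.trace_sum]
  refine Finset.sum_congr rfl fun x _ => Finset.sum_congr rfl fun e _ => ?_
  rw [Matrix.trace_mul_comm (L x e * ρ), Matrix.mul_assoc]

theorem ketbra_eq {n : Type*} (v : EuclideanSpace ℂ n) :
    ketbra v = Matrix.vecMulVec v.ofLp (star v.ofLp) := rfl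

theorem posSemidef_ketbra {n : Type*} [Fintype n] (v : EuclideanSpace ℂ n) :
    (ketbra v).PosSemidef :=
  Matrix.posSemidef_vecMulVec_self_star v.ofLp

theorem mul_ketbra_mul {m n : Type*} [Fintype m] (L : Matrix n m ℂ) (v : EuclideanSpace ℂ m) :
    L * ketbra v * Lᴴ = Matrix.vecMulVec (L *ᵥ v.ofLp) (star (L *ᵥ v.ofLp)) := by
  rw [ketbra_eq, Matrix.mul_vecMulVec, Matrix.vecMulVec_mul, ← Matrix.star_mulVec]

theorem trace_mul_vecMulVec_star {n : Type*} [Fintype n] (P : Matrix n n ℂ) (v : n → ℂ) :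
    (P * Matrix.vecMulVec v (star v)).trace = star v ⬝ᵥ (P *ᵥ v) := by
  rw [Matrix.mul_vecMulVec, Matrix.trace_vecMulVec, dotProduct_comm]

/-! ### The state after simultaneous communication -/

/-- The vector `(U ⊗ V)(|a⟩|b⟩)`, with the tensor factors `(A₀ B₁) (B₀ A₁)` rearranged as
`(A₀ A₁) (B₀ B₁)`. -/
def finalKet {α α' β β' : Type*} {m d : ℕ} (U : Matrix (α × β') (Fin m) ℂ)
    (V : Matrix (β × α') (Fin d) ℂ) (a : EuclideanSpace ℂ (Fin m))
    (b : EuclideanSpace ℂ (Fin d)) : (α × α') × (β × β') → ℂ :=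
  fun p => (U *ᵥ a.ofLp) (p.1.1, p.2.2) * (V *ᵥ b.ofLp) (p.2.1, p.1.2)

theorem LOSQCStrategy.successProb_eq {K : Type*} [Fintype K] {m d : ℕ} (S : LOSQCStrategy K m d)
    (k : K) (a : EuclideanSpace ℂ (Fin m)) (b : EuclideanSpace ℂ (Fin d)) :
    S.successProb k (ketbra (prodKet a b)) =
      star (finalKet S.U S.V a b) ⬝ᵥ
        ((S.povmA k ⊗ₖ S.povmB k) *ᵥ finalKet S.U S.V a b) := by
  rw [← trace_mul_vecMulVec_star]
  unfold LOSQCStrategy.successProb LOSQCStrategy.finalState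
  rw [mul_ketbra_mul]
  have h : (S.U ⊗ₖ S.V) *ᵥ (prodKet a b).ofLp
      = fun p => (S.U *ᵥ a.ofLp) p.1 * (S.V *ᵥ b.ofLp) p.2 := by
    ext ⟨p, q⟩
    simp only [Matrix.mulVec, dotProduct, prodKet, Fintype.sum_prod_type, Finset.sum_mul_sum,
      Matrix.kronecker_apply]
    refine Finset.sum_congr rfl fun i _ => Finset.sum_congr rfl fun j _ => ?_
    ring
  rw [h]
  rfl

theorem IsPOVM.reindex {K n n' : Type*} [Fintype K] [Fintype n] [DecidableEq n] [Fintype n']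
    [DecidableEq n'] {P : K → Matrix n n ℂ} (hP : IsPOVM P) (e : n' ≃ n) :
    IsPOVM fun k => (P k).submatrix e e := by
  refine ⟨fun k => (hP.posSemidef k).submatrix e, ?_⟩
  have := congrArg (fun M : Matrix n n ℂ => M.submatrix e e) hP.sum_eq_one
  simp only [Matrix.submatrix_one_equiv] at this
  rw [← this]
  ext i j
  simp [Matrix.sum_apply]

/-- LOSQC strategies may use registers labelled by arbitrary finite types. -/
theorem LOSQCDistinguishable.of_fintype {K : Type*} [Fintype K] {m d : ℕ}
    {a : K → EuclideanSpace ℂ (Fin m)} {b : K → EuclideanSpace ℂ (Fin d)}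
    {α α' β β' : Type*} [Fintype α] [Fintype α'] [Fintype β] [Fintype β']
    [DecidableEq α] [DecidableEq α'] [DecidableEq β] [DecidableEq β']
    {U : Matrix (α × β') (Fin m) ℂ} {V : Matrix (β × α') (Fin d) ℂ}
    (hU : Uᴴ * U = 1) (hV : Vᴴ * V = 1)
    {P : K → Matrix (α × α') (α × α') ℂ} {Q : K → Matrix (β × β') (β × β') ℂ}
    (hP : IsPOVM P) (hQ : IsPOVM Q)
    (h : ∀ k, star (finalKet U V (a k) (b k)) ⬝ᵥ
      ((P k ⊗ₖ Q k) *ᵥ finalKet U V (a k) (b k)) = 1) :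
    LOSQCDistinguishable a b := by
  let eα := (Fintype.equivFin α).symm
  let eα' := (Fintype.equivFin α').symm
  let eβ := (Fintype.equivFin β).symm
  let eβ' := (Fintype.equivFin β').symm
  refine ⟨⟨Fintype.card α, Fintype.card α', Fintype.card β, Fintype.card β',
    U.submatrix (eα.prodCongr eβ') id, V.submatrix (eβ.prodCongr eα') id, ?_, ?_,
    fun k => (P k).submatrix (eα.prodCongr eα') (eα.prodCongr eα'),
    fun k => (Q k).submatrix (eβ.prodCongr eβ') (eβ.prodCongr eβ'),
    hP.reindex _, hQ.reindex _⟩, fun k => ?_⟩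
  · rw [Matrix.conjTranspose_submatrix, Matrix.submatrix_mul_equiv, hU, Matrix.submatrix_id_id]
  · rw [Matrix.conjTranspose_submatrix, Matrix.submatrix_mul_equiv, hV, Matrix.submatrix_id_id]
  · rw [LOSQCStrategy.successProb_eq, ← h k]
    let E := (eα.prodCongr eα').prodCongr (eβ.prodCongr eβ')
    have h1 : finalKet (U.submatrix (eα.prodCongr eβ') id) (V.submatrix (eβ.prodCongr eα') id)
        (a k) (b k) = finalKet U V (a k) (b k) ∘ E := rfl
    simp only [h1]
    have h2 : ((P k).submatrix (eα.prodCongr eα') (eα.prodCongr eα') ⊗ₖ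
        (Q k).submatrix (eβ.prodCongr eβ') (eβ.prodCongr eβ')) = (P k ⊗ₖ Q k).submatrix E E := rfl
    rw [h2, Matrix.submatrix_mulVec_equiv, Function.comp_assoc, Equiv.self_comp_symm,
      Function.comp_id]
    exact comp_equiv_dotProduct_comp_equiv (star (finalKet U V (a k) (b k))) _ E

/-! ### Simulating classical by quantum communication -/

/-- The isometry `|ψ⟩ ↦ ∑ x, ∑ e, |x⟩|e⟩ (L x e |ψ⟩) |x⟩`, which keeps the environment `e` and a
copy of the outcome `x` of an instrument with Kraus operators `L x e`, and emits another copy. -/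
def broadcastIsometry {X E P : Type*} [DecidableEq X] {m : ℕ} (L : X → E → Matrix P (Fin m) ℂ) :
    Matrix (((X × E) × P) × X) (Fin m) ℂ :=
  Matrix.of fun p i => if p.1.1.1 = p.2 then L p.1.1.1 p.1.1.2 p.1.2 i else 0

theorem broadcastIsometry_isometry {X E P : Type*} [DecidableEq X] [Fintype X] [Fintype E]
    [Fintype P] {m : ℕ} {L : X → E → Matrix P (Fin m) ℂ}
    (hL : ∑ x, ∑ e, (L x e)ᴴ * L x e = 1) :
    (broadcastIsometry L)ᴴ * broadcastIsometry L = 1 := by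
  rw [← hL]
  ext i j
  simp [broadcastIsometry, Matrix.mul_apply, Fintype.sum_prod_type, Matrix.sum_apply,
    Matrix.conjTranspose_apply, apply_ite]

theorem broadcastIsometry_mulVec {X E P : Type*} [DecidableEq X] {m : ℕ}
    (L : X → E → Matrix P (Fin m) ℂ) (v : Fin m → ℂ) (x : X) (e : E) (p : P) (x' : X) :
    (broadcastIsometry L *ᵥ v) (((x, e), p), x') =
      if x = x' then (L x e *ᵥ v) p else 0 := by
  split_ifs with h <;> simp [broadcastIsometry, Matrix.mulVec, dotProduct, h]

/-- The block diagonal operator `∑ |x⟩⟨x| ⊗ 1 ⊗ R x y ⊗ |y⟩⟨y|`: apply `R x y` conditionally on the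
own outcome `x` and the received outcome `y`. -/
def controlled {X Y : Type*} (E : Type*) {P : Type*} [DecidableEq X] [DecidableEq Y]
    [DecidableEq E] (R : X → Y → Matrix P P ℂ) :
    Matrix (((X × E) × P) × Y) (((X × E) × P) × Y) ℂ :=
  Matrix.of fun i j => if i.1.1 = j.1.1 ∧ i.2 = j.2 then R i.1.1.1 i.2 i.1.2 j.1.2 else 0

theorem controlled_conjTranspose_mul_self {X Y E P : Type*} [DecidableEq X] [DecidableEq Y]
    [DecidableEq E] [Fintype X] [Fintype Y] [Fintype E] [Fintype P]
    (R : X → Y → Matrix P P ℂ) :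
    controlled E (fun x y => (R x y)ᴴ * R x y) = (controlled E R)ᴴ * controlled E R := by
  ext ⟨⟨⟨x, e⟩, p⟩, y⟩ ⟨⟨⟨x', e'⟩, p'⟩, y'⟩
  by_cases h : x = x' ∧ e = e' ∧ y = y'
  · obtain ⟨rfl, rfl, rfl⟩ := h
    simp [controlled, Matrix.mul_apply, Fintype.sum_prod_type, apply_ite, ite_and]
  · have h' : ¬ ((x = x' ∧ e = e') ∧ y = y') := by tauto
    simp only [controlled, Matrix.of_apply, Prod.mk.injEq, h', if_false, Matrix.mul_apply,
      Matrix.conjTranspose_apply]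
    symm
    refine Finset.sum_eq_zero fun j _ => ?_
    by_cases h1 : j.1.1 = (x, e) ∧ j.2 = y
    · rw [if_neg (c := j.1.1 = (x', e') ∧ _), mul_zero]
      rintro ⟨h2, h3⟩
      rw [h1.1] at h2
      rw [h1.2] at h3
      simp at h2
      tauto
    · rw [if_neg h1, star_zero, zero_mul]

open scoped MatrixOrder Matrix.Norms.L2Operator in
theorem isPOVM_controlled {K X Y E P : Type*} [DecidableEq X] [DecidableEq Y]
    [DecidableEq E] [DecidableEq P] [Fintype K] [Fintype X] [Fintype Y] [Fintype E] [Fintype P]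
    {R : X → Y → K → Matrix P P ℂ} (hR : ∀ x y, IsPOVM (R x y)) :
    IsPOVM fun k => controlled E fun x y => R x y k := by
  constructor
  · intro k
    choose B hB using fun x y =>
      CStarAlgebra.nonneg_iff_eq_star_mul_self.mp ((hR x y).posSemidef k).nonneg
    simp only [Matrix.star_eq_conjTranspose] at hB
    simp only [hB, controlled_conjTranspose_mul_self]
    exact Matrix.posSemidef_conjTranspose_mul_self _
  · ext ⟨⟨⟨x, e⟩, p⟩, y⟩ ⟨⟨⟨x', e'⟩, p'⟩, y'⟩
    have h := congrFun (congrFun (hR x y).sum_eq_one p) p'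
    rw [Matrix.sum_apply] at h ⊢
    by_cases h' : (x = x' ∧ e = e') ∧ y = y'
    · simp only [controlled, Matrix.of_apply, h']
      obtain ⟨⟨rfl, rfl⟩, rfl⟩ := h'
      simp [h, Matrix.one_apply]
    · simp only [controlled, Matrix.of_apply, Prod.mk.injEq, h', if_false, Matrix.one_apply]
      rw [if_neg (by tauto)]
      simp

theorem controlled_mulVec {X Y E P : Type*} [DecidableEq X] [DecidableEq Y]
    [DecidableEq E] [Fintype X] [Fintype Y] [Fintype E] [Fintype P]
    (R : X → Y → Matrix P P ℂ) (w : ((X × E) × P) × Y → ℂ) (x : X) (e : E) (p : P) (y : Y) :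
    (controlled E R *ᵥ w) (((x, e), p), y) = ∑ p', R x y p p' * w (((x, e), p'), y) := by
  simp only [Matrix.mulVec, dotProduct, controlled, Matrix.of_apply]
  rw [Fintype.sum_prod_type, Fintype.sum_prod_type, Finset.sum_eq_single (x, e)]
  · refine Finset.sum_congr rfl fun p' _ => ?_
    rw [Finset.sum_eq_single y]
    · simp
    · intro y' _ hy
      simp [hy.symm]
    · simp
  · intro c _ hc
    simp [hc.symm]
  · simp

theorem kronecker_mulVec_apply {α β : Type*} [Fintype α] [Fintype β] (A : Matrix α α ℂ)
    (B : Matrix β β ℂ) (w : α × β → ℂ) (i : α) (j : β) :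
    ((A ⊗ₖ B) *ᵥ w) (i, j) = (A *ᵥ fun i' => (B *ᵥ fun j' => w (i', j')) j) i := by
  simp only [Matrix.mulVec, dotProduct, Fintype.sum_prod_type, Matrix.kronecker_apply,
    Finset.mul_sum, mul_assoc]

theorem controlled_kronecker_mulVec_finalKet {X Y E F P Q : Type*} [DecidableEq X] [DecidableEq Y]
    [DecidableEq E] [DecidableEq F] [Fintype X] [Fintype Y] [Fintype E] [Fintype F]
    [Fintype P] [Fintype Q] {m d : ℕ} (R : X → Y → Matrix P P ℂ) (S : Y → X → Matrix Q Q ℂ)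
    (L : X → E → Matrix P (Fin m) ℂ) (M : Y → F → Matrix Q (Fin d) ℂ)
    (a : EuclideanSpace ℂ (Fin m)) (b : EuclideanSpace ℂ (Fin d))
    (x : X) (e : E) (p : P) (y' : Y) (y : Y) (f : F) (q : Q) (x' : X) :
    ((controlled E R ⊗ₖ controlled F S) *ᵥ
        finalKet (broadcastIsometry L) (broadcastIsometry M) a b)
        ((((x, e), p), y'), (((y, f), q), x')) =
      if x = x' ∧ y = y' then
        (R x y *ᵥ (L x e *ᵥ a.ofLp)) p * (S y x *ᵥ (M y f *ᵥ b.ofLp)) q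
      else 0 := by
  simp only [kronecker_mulVec_apply, controlled_mulVec, finalKet, broadcastIsometry_mulVec]
  by_cases h : x = x' ∧ y = y'
  · obtain ⟨rfl, rfl⟩ := h
    simp only [if_true, and_self]
    conv_rhs => rw [Matrix.mulVec, dotProduct, Matrix.mulVec, dotProduct, Finset.sum_mul_sum]
    simp only [Finset.mul_sum]
    refine Finset.sum_congr rfl fun p' _ => Finset.sum_congr rfl fun q' _ => ?_
    ring
  · rw [if_neg h]
    refine Finset.sum_eq_zero fun p' _ => ?_
    rw [Finset.sum_eq_zero, mul_zero]
    intro q' _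
    by_cases hx : x = x'
    · have hy : ¬ y = y' := fun hy => h ⟨hx, hy⟩
      simp [hy]
    · simp [hx]

theorem finalKet_broadcastIsometry_expectation {X Y E F P Q : Type*} [DecidableEq X]
    [DecidableEq Y] [DecidableEq E] [DecidableEq F] [Fintype X] [Fintype Y] [Fintype E]
    [Fintype F] [Fintype P] [Fintype Q] {m d : ℕ} (R : X → Y → Matrix P P ℂ)
    (S : Y → X → Matrix Q Q ℂ)
    (L : X → E → Matrix P (Fin m) ℂ) (M : Y → F → Matrix Q (Fin d) ℂ)
    (a : EuclideanSpace ℂ (Fin m)) (b : EuclideanSpace ℂ (Fin d)) :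
    star (finalKet (broadcastIsometry L) (broadcastIsometry M) a b) ⬝ᵥ
        ((controlled E R ⊗ₖ controlled F S) *ᵥ
          finalKet (broadcastIsometry L) (broadcastIsometry M) a b) =
      ∑ x, ∑ y, (∑ e, star (L x e *ᵥ a.ofLp) ⬝ᵥ (R x y *ᵥ (L x e *ᵥ a.ofLp))) *
        ∑ f, star (M y f *ᵥ b.ofLp) ⬝ᵥ (S y x *ᵥ (M y f *ᵥ b.ofLp)) := by
  simp only [dotProduct, Fintype.sum_prod_type, controlled_kronecker_mulVec_finalKet, mul_ite,
    mul_zero, ite_and]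
  refine Finset.sum_congr rfl fun x _ => ?_
  have key : ∀ (e : E) (p : P) (y' : Y) (y : Y) (f : F) (q : Q),
      (∑ x' : X, if x = x' then (if y = y' then
        star (finalKet (broadcastIsometry L) (broadcastIsometry M) a b)
          ((((x, e), p), y'), (((y, f), q), x')) *
          ((R x y *ᵥ (L x e *ᵥ a.ofLp)) p * (S y x *ᵥ (M y f *ᵥ b.ofLp)) q) else 0) else 0) =
      if y' = y then (star (L x e *ᵥ a.ofLp) p * (R x y *ᵥ (L x e *ᵥ a.ofLp)) p) *
        (star (M y f *ᵥ b.ofLp) q * (S y x *ᵥ (M y f *ᵥ b.ofLp)) q) else 0 := by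
    intro e p y' y f q
    rw [Finset.sum_ite_eq, if_pos (Finset.mem_univ _)]
    by_cases h : y' = y
    · subst h
      simp only [if_true, Pi.star_apply, finalKet, broadcastIsometry_mulVec, star_mul']
      ring
    · simp [h, Ne.symm h]
  simp only [key]
  have key2 : ∀ (e : E) (p : P) (y' : Y),
      (∑ y : Y, ∑ f : F, ∑ q : Q, if y' = y then
        (star (L x e *ᵥ a.ofLp) p * (R x y *ᵥ (L x e *ᵥ a.ofLp)) p) *
        (star (M y f *ᵥ b.ofLp) q * (S y x *ᵥ (M y f *ᵥ b.ofLp)) q) else 0) =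
      (star (L x e *ᵥ a.ofLp) p * (R x y' *ᵥ (L x e *ᵥ a.ofLp)) p) *
        ∑ f, ∑ q, star (M y' f *ᵥ b.ofLp) q * (S y' x *ᵥ (M y' f *ᵥ b.ofLp)) q := by
    intro e p y'
    rw [Finset.sum_eq_single y']
    · simp only [if_true, Finset.mul_sum]
    · intro y _ hy
      simp [hy.symm]
    · simp
  simp only [key2]
  have key3 : ∀ e : E, (∑ p, ∑ y, (star (L x e *ᵥ a.ofLp) p * (R x y *ᵥ (L x e *ᵥ a.ofLp)) p) *
        ∑ f, ∑ q, star (M y f *ᵥ b.ofLp) q * (S y x *ᵥ (M y f *ᵥ b.ofLp)) q) =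
      ∑ y, (∑ p, star (L x e *ᵥ a.ofLp) p * (R x y *ᵥ (L x e *ᵥ a.ofLp)) p) *
        ∑ f, ∑ q, star (M y f *ᵥ b.ofLp) q * (S y x *ᵥ (M y f *ᵥ b.ofLp)) q := by
    intro e
    rw [Finset.sum_comm]
    simp only [Finset.sum_mul]
  simp only [key3]
  rw [Finset.sum_comm]
  simp only [Finset.sum_mul]

/-- Simultaneous quantum communication is at least as powerful as classical communication. -/
theorem LOSCCDistinguishable.losqcDistinguishable {K : Type*} [Fintype K] {m d : ℕ}
    {a : K → EuclideanSpace ℂ (Fin m)} {b : K → EuclideanSpace ℂ (Fin d)}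
    (h : LOSCCDistinguishable a b) : LOSQCDistinguishable a b := by
  obtain ⟨S, hS⟩ := h
  obtain ⟨L, hL, hL1⟩ := S.instrA_isInstrument.exists_kraus
  obtain ⟨M, hM, hM1⟩ := S.instrB_isInstrument.exists_kraus
  refine LOSQCDistinguishable.of_fintype (broadcastIsometry_isometry hL1)
    (broadcastIsometry_isometry hM1) (isPOVM_controlled S.povmA_isPOVM)
    (isPOVM_controlled fun y x => S.povmB_isPOVM x y) fun k => ?_
  rw [finalKet_broadcastIsometry_expectation, ← hS k]
  unfold LOSCCStrategy.successProb
  refine Finset.sum_congr rfl fun x _ => Finset.sum_congr rfl fun y _ => ?_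
  rw [← Matrix.mul_kronecker_mul, Matrix.trace_kronecker, hL, hM, Matrix.mul_sum, Matrix.mul_sum,
    Matrix.trace_sum, Matrix.trace_sum]
  simp only [mul_ketbra_mul, trace_mul_vecMulVec_star]

/-! ### Projective measurements and instruments -/

/-- Mutually orthogonal orthogonal projections. -/
structure IsProjectionFamily {ι n : Type*} [Fintype n] (T : ι → Matrix n n ℂ) : Prop where
  isHermitian : ∀ i, (T i)ᴴ = T i
  mul_self : ∀ i, T i * T i = T i
  mul_eq_zero : ∀ i j, i ≠ j → T i * T j = 0

/-- The projective measurement with outcomes `some i` for the projections `T i`, and `none` for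
the complementary projection. -/
def completion {ι n : Type*} [Fintype ι] [DecidableEq n] (T : ι → Matrix n n ℂ) :
    Option ι → Matrix n n ℂ
  | none => 1 - ∑ i, T i
  | some i => T i

theorem sum_completion {ι n : Type*} [Fintype ι] [DecidableEq n] (T : ι → Matrix n n ℂ) :
    ∑ z, completion T z = 1 := by
  simp [Fintype.sum_option, completion]

theorem IsProjectionFamily.sum_mul {ι n : Type*} [Fintype n] [Fintype ι]
    {T : ι → Matrix n n ℂ} (hT : IsProjectionFamily T) (i : ι) : (∑ j, T j) * T i = T i := by
  rw [Matrix.sum_mul, Finset.sum_eq_single i]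
  · exact hT.mul_self i
  · exact fun j _ hj => hT.mul_eq_zero j i hj
  · simp

theorem IsProjectionFamily.mul_sum {ι n : Type*} [Fintype n] [Fintype ι]
    {T : ι → Matrix n n ℂ} (hT : IsProjectionFamily T) (i : ι) : T i * ∑ j, T j = T i := by
  rw [Matrix.mul_sum, Finset.sum_eq_single i]
  · exact hT.mul_self i
  · exact fun j _ hj => hT.mul_eq_zero i j hj.symm
  · simp

theorem IsProjectionFamily.completion {ι n : Type*} [Fintype n] [Fintype ι] [DecidableEq n]
    {T : ι → Matrix n n ℂ} (hT : IsProjectionFamily T) : IsProjectionFamily (completion T) := by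
  have hs : (∑ i, T i) * ∑ i, T i = ∑ i, T i := by
    rw [Matrix.mul_sum]
    exact Finset.sum_congr rfl fun i _ => hT.sum_mul i
  constructor
  · rintro (_ | i)
    · simp [LocalDiscrimination.completion, Matrix.conjTranspose_sum, hT.isHermitian]
    · exact hT.isHermitian i
  · rintro (_ | i)
    · simp [LocalDiscrimination.completion, mul_sub, sub_mul, hs]
    · exact hT.mul_self i
  · rintro (_ | i) (_ | j) hij
    · exact absurd rfl hij
    · simp [LocalDiscrimination.completion, sub_mul, hT.sum_mul]
    · simp [LocalDiscrimination.completion, mul_sub, hT.mul_sum]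
    · exact hT.mul_eq_zero i j fun h => hij (congrArg some h)

theorem IsProjectionFamily.sum_conjTranspose_mul_self {ι n : Type*} [Fintype n] [Fintype ι]
    [DecidableEq n] {T : ι → Matrix n n ℂ} (hT : IsProjectionFamily T) (h1 : ∑ i, T i = 1) :
    ∑ i, (T i)ᴴ * T i = 1 := by
  simp only [hT.isHermitian, hT.mul_self, h1]

/-- The Lüders instrument with Kraus operators `L z`, followed by an instrument `ℰ`. -/
theorem IsInstrument.comp_conjMap {Z X m n l : Type*} [Fintype Z] [Fintype X] [Fintype m]
    [Fintype n] [Fintype l] [DecidableEq m] {L : Z → Matrix n m ℂ} (hL : ∑ z, (L z)ᴴ * L z = 1)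
    {ℰ : X → Matrix n n ℂ →ₗ[ℂ] Matrix l l ℂ} (hℰ : IsInstrument ℰ) :
    IsInstrument fun p : Z × X => ℰ p.2 ∘ₗ conjMap (L p.1) := by
  refine ⟨fun p => (hℰ.completelyPositive p.2).comp (isCompletelyPositive_conjMap _),
    fun ρ => ?_⟩
  simp only [Fintype.sum_prod_type, LinearMap.comp_apply, conjMap_apply, Matrix.trace_sum]
  have h : ∀ z, ∑ x, (ℰ x (L z * ρ * (L z)ᴴ)).trace = ((L z)ᴴ * L z * ρ).trace := by
    intro z
    rw [← Matrix.trace_sum, hℰ.tracePreserving, Matrix.trace_mul_comm, Matrix.mul_assoc]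
  simp only [h]
  rw [← Matrix.trace_sum, ← Matrix.sum_mul, hL, one_mul]

theorem isInstrument_conjMap {X m n : Type*} [Fintype X] [Fintype m] [Fintype n]
    [DecidableEq m] {L : X → Matrix n m ℂ} (hL : ∑ x, (L x)ᴴ * L x = 1) :
    IsInstrument fun x => conjMap (L x) := by
  refine ⟨fun x => isCompletelyPositive_conjMap _, fun ρ => ?_⟩
  have h : ∀ x, (conjMap (L x) ρ).trace = ((L x)ᴴ * L x * ρ).trace := by
    intro x
    rw [conjMap_apply, Matrix.trace_mul_comm, Matrix.mul_assoc]
  simp only [Matrix.trace_sum, h]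
  rw [← Matrix.trace_sum, ← Matrix.sum_mul, hL, one_mul]

theorem IsInstrument.reindex {X Y m n : Type*} [Fintype X] [Fintype Y] [Fintype m] [Fintype n]
    {ℰ : X → Matrix m m ℂ →ₗ[ℂ] Matrix n n ℂ} (hℰ : IsInstrument ℰ) (e : Y ≃ X) :
    IsInstrument fun y => ℰ (e y) :=
  ⟨fun y => hℰ.completelyPositive (e y), fun ρ => by
    rw [e.sum_comp fun x => ℰ x ρ, hℰ.tracePreserving]⟩

/-! ### Kets -/

theorem isHermitian_ketbra {n : Type*} (v : EuclideanSpace ℂ n) : (ketbra v)ᴴ = ketbra v := by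
  rw [ketbra_eq, Matrix.conjTranspose_vecMulVec, star_star]

theorem ketbra_mulVec {n : Type*} [Fintype n] (v : EuclideanSpace ℂ n) (w : EuclideanSpace ℂ n) :
    ketbra v *ᵥ w.ofLp = inner ℂ v w • v.ofLp := by
  rw [ketbra_eq, Matrix.vecMulVec_mulVec, EuclideanSpace.inner_eq_star_dotProduct,
    dotProduct_comm]
  simp

theorem ketbra_mul_ketbra {n : Type*} [Fintype n] (v w : EuclideanSpace ℂ n) :
    ketbra v * ketbra w = inner ℂ v w • Matrix.vecMulVec v.ofLp (star w.ofLp) := by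
  rw [ketbra_eq w, Matrix.mul_vecMulVec, ketbra_mulVec, Matrix.smul_vecMulVec]

theorem ketbra_mul_self {n : Type*} [Fintype n] {v : EuclideanSpace ℂ n} (hv : ‖v‖ = 1) :
    ketbra v * ketbra v = ketbra v := by
  rw [ketbra_mul_ketbra, inner_self_eq_norm_sq_to_K, hv, ketbra_eq]
  simp

theorem trace_ketbra {n : Type*} [Fintype n] {v : EuclideanSpace ℂ n} (hv : ‖v‖ = 1) :
    (ketbra v).trace = 1 := by
  rw [ketbra_eq, Matrix.trace_vecMulVec, ← EuclideanSpace.inner_eq_star_dotProduct,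
    inner_self_eq_norm_sq_to_K, hv]
  simp

theorem sum_ketbra_orthonormalBasis {ι n : Type*} [Fintype ι] [Fintype n] [DecidableEq n]
    (e : OrthonormalBasis ι ℂ (EuclideanSpace ℂ n)) : ∑ i, ketbra (e i) = 1 := by
  refine Matrix.mulVec_injective (funext fun v => ?_)
  rw [Matrix.sum_mulVec, Matrix.one_mulVec]
  have h := congrArg WithLp.ofLp (e.sum_repr' (WithLp.toLp 2 v))
  simpa [← ketbra_mulVec] using h

theorem isProjectionFamily_ketbra {ι n : Type*} [Fintype n] {v : ι → EuclideanSpace ℂ n}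
    (hv : Orthonormal ℂ v) : IsProjectionFamily fun i => ketbra (v i) :=
  ⟨fun i => isHermitian_ketbra _, fun i => ketbra_mul_self (hv.1 i), fun i j hij => by
    rw [ketbra_mul_ketbra, hv.2 hij, zero_smul]⟩

/-- Equal product kets of unit vectors have the same marginal states. -/
theorem ketbra_eq_of_prodKet_eq {m d : ℕ} {a α : EuclideanSpace ℂ (Fin m)}
    {b β : EuclideanSpace ℂ (Fin d)} (h : prodKet a b = prodKet α β) (ha : ‖a‖ = 1)
    (hb : ‖b‖ = 1) (hα : ‖α‖ = 1) (hβ : ‖β‖ = 1) :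
    ketbra a = ketbra α ∧ ketbra b = ketbra β := by
  have h' : ∀ i j, a i * b j = α i * β j := fun i j => congrFun (congrArg WithLp.ofLp h) (i, j)
  have hsum : ∀ {n : ℕ} (v : EuclideanSpace ℂ (Fin n)), ‖v‖ = 1 → ∑ i, v i * star (v i) = 1 :=
    fun v hv => trace_ketbra hv
  constructor
  · ext i i'
    calc a i * star (a i') = ∑ j, (a i * b j) * star (a i' * b j) := by
          rw [← mul_one (a i * star (a i')), ← hsum b hb, Finset.mul_sum]
          refine Finset.sum_congr rfl fun j _ => ?_
          rw [star_mul']; ring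
      _ = α i * star (α i') := by
          simp only [h']
          rw [← mul_one (α i * star (α i')), ← hsum β hβ, Finset.mul_sum]
          refine Finset.sum_congr rfl fun j _ => ?_
          rw [star_mul']; ring
  · ext i i'
    calc b i * star (b i') = ∑ j, (a j * b i) * star (a j * b i') := by
          rw [← mul_one (b i * star (b i')), ← hsum a ha, Finset.mul_sum]
          refine Finset.sum_congr rfl fun j _ => ?_
          rw [star_mul']; ring
      _ = β i * star (β i') := by
          simp only [h']
          rw [← mul_one (β i * star (β i')), ← hsum α hα, Finset.mul_sum]
          refine Finset.sum_congr rfl fun j _ => ?_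
          rw [star_mul']; ring

/-! ### Broadcast form implies distinguishability by classical communication -/

theorem traceRight_qcMap {X m n : Type*} [Fintype X] [DecidableEq X]
    (𝒜 : X → Matrix m m ℂ →ₗ[ℂ] Matrix n n ℂ) (ρ : Matrix m m ℂ) :
    traceRight (qcMap 𝒜 ρ) = ∑ x, 𝒜 x ρ := by
  ext i j
  simp [traceRight, qcMap, Matrix.sum_apply, Matrix.single_apply]

theorem traceLeft_qcMap {X m n : Type*} [Fintype X] [DecidableEq X] [Fintype n]
    (𝒜 : X → Matrix m m ℂ →ₗ[ℂ] Matrix n n ℂ) (ρ : Matrix m m ℂ) :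
    traceLeft (qcMap 𝒜 ρ) = Matrix.diagonal fun x => (𝒜 x ρ).trace := by
  ext x y
  by_cases h : x = y
  · subst h
    simp [traceLeft, qcMap, Matrix.sum_apply, Matrix.single_apply, Matrix.trace]
  · have : ∀ z, ¬ (z = x ∧ z = y) := fun z hz => h (hz.1.symm.trans hz.2)
    simp [traceLeft, qcMap, Matrix.sum_apply, Matrix.single_apply, h, this]

theorem isPOVM_ite {K n : Type*} [Fintype K] [DecidableEq K] [Fintype n] [DecidableEq n] (g : K) :
    IsPOVM fun k => if g = k then (1 : Matrix n n ℂ) else 0 := by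
  refine ⟨fun k => ?_, by simp⟩
  split_ifs
  · exact Matrix.PosSemidef.one
  · exact Matrix.PosSemidef.zero

/-- If the outcomes of local instruments already determine `k`, both parties announce it. -/
theorem LOSCCDistinguishable.of_guess {K : Type*} [Fintype K] {m d : ℕ}
    {a : K → EuclideanSpace ℂ (Fin m)} {b : K → EuclideanSpace ℂ (Fin d)}
    (ha : ∀ k, ‖a k‖ = 1) (hb : ∀ k, ‖b k‖ = 1) {X Y : Type*} [Fintype X] [Fintype Y] {n n' : ℕ}
    {𝒜 : X → Matrix (Fin m) (Fin m) ℂ →ₗ[ℂ] Matrix (Fin n) (Fin n) ℂ}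
    {ℬ : Y → Matrix (Fin d) (Fin d) ℂ →ₗ[ℂ] Matrix (Fin n') (Fin n') ℂ}
    (h𝒜 : IsInstrument 𝒜) (hℬ : IsInstrument ℬ) (g : X → Y → K)
    (hg : ∀ k x y, (𝒜 x (ketbra (a k))).trace ≠ 0 → (ℬ y (ketbra (b k))).trace ≠ 0 → g x y = k) :
    LOSCCDistinguishable a b := by
  classical
  let eX := (Fintype.equivFin X).symm
  let eY := (Fintype.equivFin Y).symm
  refine ⟨⟨n, n', Fintype.card X, Fintype.card Y, fun x => 𝒜 (eX x), fun y => ℬ (eY y),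
    h𝒜.reindex eX, hℬ.reindex eY, fun x y k => if g (eX x) (eY y) = k then 1 else 0,
    fun x y k => if g (eX x) (eY y) = k then 1 else 0,
    fun x y => isPOVM_ite _, fun x y => isPOVM_ite _⟩, fun k => ?_⟩
  unfold LOSCCStrategy.successProb
  have h : ∀ x y, (((if g x y = k then (1 : Matrix (Fin n) (Fin n) ℂ) else 0) ⊗ₖ
      (if g x y = k then (1 : Matrix (Fin n') (Fin n') ℂ) else 0)) *
      (𝒜 x (ketbra (a k)) ⊗ₖ ℬ y (ketbra (b k)))).trace =
      (𝒜 x (ketbra (a k))).trace * (ℬ y (ketbra (b k))).trace := by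
    intro x y
    rw [← Matrix.mul_kronecker_mul, Matrix.trace_kronecker]
    split_ifs with hk
    · simp
    · by_cases h1 : (𝒜 x (ketbra (a k))).trace = 0
      · simp [h1]
      · by_cases h2 : (ℬ y (ketbra (b k))).trace = 0
        · simp [h2]
        · exact absurd (hg k x y h1 h2) hk
  simp only [h]
  rw [eX.sum_comp fun x => ∑ y, (𝒜 x (ketbra (a k))).trace * (ℬ (eY y) (ketbra (b k))).trace]
  have h2 : ∀ x, ∑ y, (𝒜 x (ketbra (a k))).trace * (ℬ (eY y) (ketbra (b k))).trace =
      ∑ y, (𝒜 x (ketbra (a k))).trace * (ℬ y (ketbra (b k))).trace := fun x =>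
    eY.sum_comp fun y => (𝒜 x (ketbra (a k))).trace * (ℬ y (ketbra (b k))).trace
  simp only [h2]
  rw [← Finset.sum_mul_sum, ← Matrix.trace_sum, ← Matrix.trace_sum, h𝒜.tracePreserving,
    hℬ.tracePreserving, trace_ketbra (ha k), trace_ketbra (hb k), one_mul]

/-- Bob first measures the projections onto the `t_i` and, if none of them occurs, applies the
broadcasting instrument; Alice measures in the basis `e`. The two outcomes determine `k`. -/
theorem HasBroadcastForm.losccDistinguishable {K : Type*} [Fintype K] [Nonempty K] {d : ℕ}
    {a : K → EuclideanSpace ℂ (Fin 2)} {b : K → EuclideanSpace ℂ (Fin d)}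
    (ha : ∀ k, ‖a k‖ = 1) (hb : ∀ k, ‖b k‖ = 1) (h : HasBroadcastForm a b) :
    LOSCCDistinguishable a b := by
  classical
  obtain ⟨e, α, β, label, hαβ, hlabel, -, ⟨n, N, ℰ, hℰ, hbc⟩, hnone⟩ := h
  have hka : ∀ k, ketbra (a k) = ketbra (α k) ∧ ketbra (b k) = ketbra (β k) := fun k =>
    ketbra_eq_of_prodKet_eq (hαβ k).2.2 (ha k) (hb k) (hαβ k).1 (hαβ k).2.1
  have hT : IsProjectionFamily fun i : {k // label k = none} => ketbra (β i) := by
    refine isProjectionFamily_ketbra ⟨fun i => (hαβ i).2.1, fun i j hij => ?_⟩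
    exact hnone i i.2 j fun h => hij (Subtype.ext h).symm
  let T := completion fun i : {k // label k = none} => ketbra (β i)
  have hT' : IsProjectionFamily T := hT.completion
  have hTsome : ∀ (i : {k // label k = none}) (k : K), (i : K) ≠ k →
      T (some i) * ketbra (β k) = 0 := by
    intro i k hik
    change ketbra (β i) * ketbra (β k) = 0
    rw [ketbra_mul_ketbra, hnone i i.2 k hik.symm, zero_smul]
  -- the detector for the complement of the `t_i` never fires on a `t_k`, and preserves the others
  have hTnone0 : ∀ k, label k = none → T none * ketbra (β k) = 0 := fun k hk =>
    hT'.mul_eq_zero none (some ⟨k, hk⟩) (by simp)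
  have hTnone1 : ∀ k, label k ≠ none → T none * ketbra (β k) = ketbra (β k) := by
    intro k hk
    change (1 - ∑ i : {k // label k = none}, ketbra (β i)) * ketbra (β k) = ketbra (β k)
    rw [sub_mul, one_mul, Matrix.sum_mul, Finset.sum_eq_zero, sub_zero]
    intro i _
    exact hTsome i k fun h => hk (h ▸ i.2)
  have hdet : ∀ (θ : Fin 2) (x : Fin N) (i j : K), label i = some θ → label j = some θ →
      (ℰ x (ketbra (β i))).trace ≠ 0 → (ℰ x (ketbra (β j))).trace ≠ 0 → i = j := by
    intro θ x i j hi hj hxi hxj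
    by_contra hij
    have h1 := (hbc θ ⟨i, hi⟩ ⟨j, hj⟩ fun h => hij (congrArg Subtype.val h)).2
    rw [OrthogonalStates, traceLeft_qcMap, traceLeft_qcMap, Matrix.diagonal_mul_diagonal,
      Matrix.trace_diagonal] at h1
    have hnn : ∀ y k, 0 ≤ (ℰ y (ketbra (β k))).trace := fun y k =>
      ((hℰ.completelyPositive y).map_posSemidef (posSemidef_ketbra _)).trace_nonneg
    have h2 := (Finset.sum_eq_zero_iff_of_nonneg fun y _ => mul_nonneg (hnn y i) (hnn y j)).mp h1
      x (Finset.mem_univ x)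
    exact (mul_ne_zero hxi hxj) h2
  have hA : ∑ θ, (ketbra (e θ))ᴴ * ketbra (e θ) = 1 :=
    (isProjectionFamily_ketbra e.orthonormal).sum_conjTranspose_mul_self
      (sum_ketbra_orthonormalBasis e)
  have hB : ∑ z, (T z)ᴴ * T z = 1 := hT'.sum_conjTranspose_mul_self (sum_completion _)
  let good : Fin 2 → Fin N → K → Prop := fun θ x k =>
    label k = some θ ∧ (ℰ x (ketbra (β k))).trace ≠ 0
  let g : Fin 2 → Option {k // label k = none} × Fin N → K := fun θ y =>
    match y.1 with
    | some i => i
    | none => if hex : ∃ k, good θ y.2 k then hex.choose else Classical.arbitrary K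
  refine LOSCCDistinguishable.of_guess ha hb (isInstrument_conjMap hA)
    (IsInstrument.comp_conjMap hB hℰ) g ?_
  rintro k θ ⟨z, x⟩ hp hq
  rw [(hka k).1, conjMap_apply] at hp
  simp only [(hka k).2, LinearMap.comp_apply, conjMap_apply] at hq
  have hzk : T z * ketbra (β k) ≠ 0 := by
    intro h0
    simp [h0] at hq
  rcases z with _ | i
  · have hk : label k ≠ none := fun hk => hzk (hTnone0 k hk)
    obtain ⟨θ', hθ'⟩ := Option.ne_none_iff_exists'.mp hk
    have hθ : θ' = θ := by
      by_contra hne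
      rw [hlabel k θ' hθ', ketbra_mul_ketbra, e.orthonormal.2 (Ne.symm hne)] at hp
      simp at hp
    subst hθ
    have hkx : good θ' x k := by
      refine ⟨hθ', ?_⟩
      have h1 := hTnone1 k hk
      have h2 : T none * ketbra (β k) * (T none)ᴴ = ketbra (β k) := by
        rw [h1, ← isHermitian_ketbra, ← Matrix.conjTranspose_mul, h1]
      rwa [h2] at hq
    have hex : ∃ k, good θ' x k := ⟨k, hkx⟩
    have hgk : g θ' (none, x) = hex.choose := dif_pos hex
    rw [hgk]
    exact hdet θ' x _ _ hex.choose_spec.1 hkx.1 hex.choose_spec.2 hkx.2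
  · by_contra hne
    exact hzk (hTsome i k hne)

/-! ### Orthogonality conditions for quantum communication -/

/-- A vector of `α ⊗ β` read as an `α × β` matrix `W`: up to transposition, its reduced states are
`W * Wᴴ` and `Wᴴ * W`. -/
def ketMatrix {α β : Type*} (w : α × β → ℂ) : Matrix α β ℂ := Matrix.of fun i j => w (i, j)

/-- The output ket of an isometry `U` into `α ⊗ β`, read as an `α × β` matrix. -/
def outMatrix {α β n : Type*} [Fintype n] (U : Matrix (α × β) n ℂ) (v : EuclideanSpace ℂ n) :
    Matrix α β ℂ :=
  ketMatrix (U *ᵥ v.ofLp)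

theorem outMatrix_add {α β n : Type*} [Fintype n] (U : Matrix (α × β) n ℂ)
    (v w : EuclideanSpace ℂ n) : outMatrix U (v + w) = outMatrix U v + outMatrix U w := by
  ext i j
  simp [outMatrix, ketMatrix, Matrix.mulVec_add]

theorem outMatrix_smul {α β n : Type*} [Fintype n] (U : Matrix (α × β) n ℂ) (c : ℂ)
    (v : EuclideanSpace ℂ n) : outMatrix U (c • v) = c • outMatrix U v := by
  ext i j
  simp [outMatrix, ketMatrix, Matrix.mulVec_smul]

theorem ketMatrix_kronecker_mulVec {α β : Type*} [Fintype α] [Fintype β] (P : Matrix α α ℂ)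
    (Q : Matrix β β ℂ) (w : α × β → ℂ) :
    ketMatrix ((P ⊗ₖ Q) *ᵥ w) = P * (ketMatrix w * Qᵀ) := by
  ext i j
  simp only [ketMatrix, Matrix.of_apply, kronecker_mulVec_apply]
  simp only [Matrix.mulVec, dotProduct, Matrix.mul_apply, Matrix.transpose_apply, Matrix.of_apply]
  simp only [mul_comm (Q j _)]

theorem ketMatrix_eq_zero {α β : Type*} {w : α × β → ℂ} : ketMatrix w = 0 ↔ w = 0 :=
  ⟨fun h => funext fun p => congrFun (congrFun h p.1) p.2, fun h => by subst h; rfl⟩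

theorem trace_outMatrix {α β n : Type*} [Fintype α] [Fintype β] [Fintype n] [DecidableEq n]
    {U : Matrix (α × β) n ℂ} (hU : Uᴴ * U = 1) (v w : EuclideanSpace ℂ n) :
    ((outMatrix U v)ᴴ * outMatrix U w).trace = inner ℂ v w := by
  have h : star (U *ᵥ v.ofLp) ⬝ᵥ (U *ᵥ w.ofLp) = inner ℂ v w := by
    rw [Matrix.star_mulVec, ← Matrix.dotProduct_mulVec, Matrix.mulVec_mulVec, hU,
      Matrix.one_mulVec, EuclideanSpace.inner_eq_star_dotProduct, dotProduct_comm]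
  rw [← h]
  simp only [Matrix.trace, Matrix.diag, Matrix.mul_apply, outMatrix, ketMatrix, dotProduct,
    Fintype.sum_prod_type, Matrix.conjTranspose_apply, Matrix.of_apply, Pi.star_apply]
  exact Finset.sum_comm

theorem inner_eq_zero_of_conjTranspose_mul {α β n : Type*} [Fintype α] [Fintype β] [Fintype n]
    [DecidableEq n] {U : Matrix (α × β) n ℂ} (hU : Uᴴ * U = 1) {v w : EuclideanSpace ℂ n}
    (h : (outMatrix U v)ᴴ * outMatrix U w = 0) : inner ℂ v w = 0 := by
  rw [← trace_outMatrix hU, h, Matrix.trace_zero]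

theorem inner_eq_zero_of_mul_conjTranspose {α β n : Type*} [Fintype α] [Fintype β] [Fintype n]
    [DecidableEq n] {U : Matrix (α × β) n ℂ} (hU : Uᴴ * U = 1) {v w : EuclideanSpace ℂ n}
    (h : outMatrix U w * (outMatrix U v)ᴴ = 0) : inner ℂ v w = 0 := by
  rw [← trace_outMatrix hU, Matrix.trace_mul_comm, h, Matrix.trace_zero]

theorem IsPOVM.kronecker {K α β : Type*} [Fintype K] [Fintype α] [Fintype β] [DecidableEq α]
    [DecidableEq β] {P : K → Matrix α α ℂ} {Q : K → Matrix β β ℂ} (hP : IsPOVM P)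
    (hQ : IsPOVM Q) : IsPOVM fun p : K × K => P p.1 ⊗ₖ Q p.2 := by
  refine ⟨fun p => (hP.posSemidef p.1).kronecker (hQ.posSemidef p.2), ?_⟩
  rw [← Matrix.one_kronecker_one, ← hP.sum_eq_one, ← hQ.sum_eq_one, Fintype.sum_prod_type]
  ext ⟨i, i'⟩ ⟨j, j'⟩
  simp only [Matrix.sum_apply, Matrix.kronecker_apply, Finset.sum_mul_sum]

/-- An outcome of a measurement that occurs with certainty excludes all others. -/
theorem IsPOVM.mulVec_eq_zero {K n : Type*} [Fintype K] [Fintype n] [DecidableEq n]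
    {P : K → Matrix n n ℂ} (hP : IsPOVM P) {w : n → ℂ} {k : K}
    (h : star w ⬝ᵥ (P k *ᵥ w) = star w ⬝ᵥ w) {l : K} (hl : l ≠ k) : P l *ᵥ w = 0 := by
  classical
  have hsum : ∑ j, star w ⬝ᵥ (P j *ᵥ w) = star w ⬝ᵥ w := by
    rw [← dotProduct_sum, ← Matrix.sum_mulVec, hP.sum_eq_one, Matrix.one_mulVec]
  rw [← Finset.add_sum_erase _ _ (Finset.mem_univ k), h, add_eq_left] at hsum
  have h0 := (Finset.sum_eq_zero_iff_of_nonneg fun j _ =>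
    (hP.posSemidef j).dotProduct_mulVec_nonneg w).mp hsum l
      (Finset.mem_erase.mpr ⟨hl, Finset.mem_univ l⟩)
  exact ((hP.posSemidef l).dotProduct_mulVec_zero_iff w).mp h0

/-- States that a local measurement identifies have orthogonal reduced states. -/
theorem IsPOVM.conjTranspose_mul_eq_zero {K α β : Type*} [Fintype K] [Fintype α] [DecidableEq α]
    {P : K → Matrix α α ℂ} (hP : IsPOVM P) {W : K → Matrix α β ℂ}
    (hW : ∀ k l, k ≠ l → P k * W l = 0) {k l : K} (hkl : k ≠ l) : (W k)ᴴ * W l = 0 := by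
  have h1 : P l * W l = W l := by
    conv_rhs => rw [← Matrix.one_mul (W l), ← hP.sum_eq_one, Matrix.sum_mul]
    rw [Finset.sum_eq_single l (fun j _ hj => hW j l hj) (by simp)]
  rw [← h1, ← Matrix.mul_assoc, ← (hP.posSemidef l).isHermitian, ← Matrix.conjTranspose_mul,
    hW l k hkl.symm, Matrix.conjTranspose_zero, Matrix.zero_mul]

theorem eq_zero_or_eq_zero_of_kronecker {α β γ δ : Type*} {M : Matrix α β ℂ} {N : Matrix γ δ ℂ}
    (h : ∀ i j i' j', M i j * N i' j' = 0) : M = 0 ∨ N = 0 := by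
  by_contra! hMN
  obtain ⟨hM, hN⟩ := hMN
  apply hM
  ext i j
  by_contra hij
  exact hN (Matrix.ext fun i' j' => (mul_eq_zero.mp (h i j i' j')).resolve_left hij)

theorem finalKet_eq {α α' β β' : Type*} {m d : ℕ} (U : Matrix (α × β') (Fin m) ℂ)
    (V : Matrix (β × α') (Fin d) ℂ) (a : EuclideanSpace ℂ (Fin m)) (b : EuclideanSpace ℂ (Fin d))
    (i : α) (i' : α') (j : β) (j' : β') :
    finalKet U V a b ((i, i'), (j, j')) = outMatrix U a i j' * outMatrix V b j i' := rfl

theorem star_finalKet_dotProduct {α α' β β' : Type*} [Fintype α] [Fintype α'] [Fintype β]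
    [Fintype β'] {m d : ℕ} {U : Matrix (α × β') (Fin m) ℂ}
    {V : Matrix (β × α') (Fin d) ℂ} (hU : Uᴴ * U = 1) (hV : Vᴴ * V = 1)
    (a : EuclideanSpace ℂ (Fin m)) (b : EuclideanSpace ℂ (Fin d)) :
    star (finalKet U V a b) ⬝ᵥ finalKet U V a b = inner ℂ a a * inner ℂ b b := by
  have hsum : ∀ (f : α → β' → ℂ) (g : β → α' → ℂ),
      ∑ i, ∑ i', ∑ j, ∑ j', f i j' * g j i' = (∑ j', ∑ i, f i j') * ∑ i', ∑ j, g j i' := by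
    intro f g
    rw [Finset.sum_comm (f := fun j' i => f i j'), Finset.sum_mul]
    refine Finset.sum_congr rfl fun i _ => ?_
    rw [Finset.mul_sum]
    refine Finset.sum_congr rfl fun i' _ => ?_
    rw [Finset.mul_sum]
    exact Finset.sum_congr rfl fun j _ => (Finset.sum_mul _ _ _).symm
  rw [← trace_outMatrix hU, ← trace_outMatrix hV]
  simp only [Matrix.trace, Matrix.diag, Matrix.mul_apply, Matrix.conjTranspose_apply]
  rw [← hsum fun i j => star (outMatrix U a i j) * outMatrix U a i j]
  simp only [dotProduct, Fintype.sum_prod_type, finalKet_eq, Pi.star_apply, star_mul']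
  refine Finset.sum_congr rfl fun i _ => Finset.sum_congr rfl fun i' _ =>
    Finset.sum_congr rfl fun j _ => Finset.sum_congr rfl fun j' _ => ?_
  ring

/-- For perfect discrimination by simultaneous quantum communication, each party's final reduced
states have to be orthogonal, and since they are product states, one of their factors must be. -/
theorem LOSQCDistinguishable.exists_isometries {K : Type*} [Fintype K] {m d : ℕ}
    {a : K → EuclideanSpace ℂ (Fin m)} {b : K → EuclideanSpace ℂ (Fin d)}
    (ha : ∀ k, ‖a k‖ = 1) (hb : ∀ k, ‖b k‖ = 1) (h : LOSQCDistinguishable a b) :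
    ∃ (n n' l l' : ℕ) (U : Matrix (Fin n × Fin l') (Fin m) ℂ)
      (V : Matrix (Fin l × Fin n') (Fin d) ℂ), Uᴴ * U = 1 ∧ Vᴴ * V = 1 ∧ ∀ i j, i ≠ j →
        ((outMatrix U (a i))ᴴ * outMatrix U (a j) = 0 ∨
          outMatrix V (b j) * (outMatrix V (b i))ᴴ = 0) ∧
        (outMatrix U (a j) * (outMatrix U (a i))ᴴ = 0 ∨
          (outMatrix V (b i))ᴴ * outMatrix V (b j) = 0) := by
  obtain ⟨S, hS⟩ := h
  refine ⟨_, _, _, _, S.U, S.V, S.U_isometry, S.V_isometry, fun i j hij => ?_⟩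
  let w := fun k => finalKet S.U S.V (a k) (b k)
  have hw : ∀ k, star (w k) ⬝ᵥ ((S.povmA k ⊗ₖ S.povmB k) *ᵥ w k) = star (w k) ⬝ᵥ w k := by
    intro k
    rw [star_finalKet_dotProduct S.U_isometry S.V_isometry, ← S.successProb_eq, hS,
      inner_self_eq_norm_sq_to_K, inner_self_eq_norm_sq_to_K, ha, hb]
    simp
  have h0 : ∀ k p, p ≠ (k, k) → S.povmA p.1 * (ketMatrix (w k) * (S.povmB p.2)ᵀ) = 0 := by
    intro k p hp
    rw [← ketMatrix_kronecker_mulVec, ketMatrix_eq_zero]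
    exact (S.povmA_isPOVM.kronecker S.povmB_isPOVM).mulVec_eq_zero (k := (k, k)) (hw k) hp
  have hA : ∀ k l, k ≠ l → S.povmA k * ketMatrix (w l) = 0 := by
    intro k l hkl
    rw [← Matrix.mul_one (ketMatrix (w l)), ← Matrix.transpose_one, ← S.povmB_isPOVM.sum_eq_one,
      Matrix.transpose_sum, Matrix.mul_sum, Matrix.mul_sum]
    exact Finset.sum_eq_zero fun q _ => h0 l (k, q) fun h => hkl (congrArg Prod.fst h)
  have hB : ∀ k l, k ≠ l → S.povmB k * (ketMatrix (w l))ᵀ = 0 := by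
    intro k l hkl
    have : ketMatrix (w l) * (S.povmB k)ᵀ = 0 := by
      rw [← Matrix.one_mul (ketMatrix (w l) * _), ← S.povmA_isPOVM.sum_eq_one, Matrix.sum_mul]
      exact Finset.sum_eq_zero fun q _ => h0 l (q, k) fun h => hkl (congrArg Prod.snd h)
    rw [← Matrix.transpose_transpose (S.povmB k), ← Matrix.transpose_mul, this,
      Matrix.transpose_zero]
  have hA' := S.povmA_isPOVM.conjTranspose_mul_eq_zero hA hij
  have hB' := S.povmB_isPOVM.conjTranspose_mul_eq_zero hB hij
  constructor
  · refine eq_zero_or_eq_zero_of_kronecker fun p q r s => ?_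
    have := congrFun (congrFun hA' (s, p)) (r, q)
    rw [Matrix.zero_apply] at this
    rw [← this]
    simp only [Matrix.mul_apply, Finset.sum_mul_sum, Fintype.sum_prod_type,
      Matrix.conjTranspose_apply, ketMatrix, Matrix.of_apply, w, finalKet_eq, star_mul']
    refine Finset.sum_congr rfl fun x _ => Finset.sum_congr rfl fun y _ => ?_
    ring
  · refine eq_zero_or_eq_zero_of_kronecker fun p q r s => ?_
    have := congrFun (congrFun hB' (q, r)) (p, s)
    rw [Matrix.zero_apply] at this
    rw [← this]
    simp only [Matrix.mul_apply, Finset.sum_mul_sum, Fintype.sum_prod_type,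
      Matrix.conjTranspose_apply, ketMatrix, Matrix.of_apply, w, finalKet_eq, star_mul',
      Matrix.transpose_apply]
    rw [Finset.sum_comm]
    refine Finset.sum_congr rfl fun x _ => Finset.sum_congr rfl fun y _ => ?_
    ring

/-! ### Range projections and classical broadcasting -/

/-- The orthogonal projection onto the range of `B`. The factorization `P = B * C` records that
its range is not larger. -/
theorem exists_range_projection {α β : Type*} [Fintype α] [Fintype β] (B : Matrix α β ℂ) :
    ∃ (P : Matrix α α ℂ) (C : Matrix β α ℂ), Pᴴ = P ∧ P * B = B ∧ P = B * C := by
  classical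
  have hH : (B * Bᴴ).IsHermitian := Matrix.isHermitian_mul_conjTranspose_self B
  let u : Matrix α α ℂ := hH.eigenvectorUnitary
  have hu : uᴴ * u = 1 := Unitary.coe_star_mul_self hH.eigenvectorUnitary
  let D : (α → ℂ) → Matrix α α ℂ := fun f => u * Matrix.diagonal f * uᴴ
  have hD : ∀ f g, D f * D g = D fun i => f i * g i := by
    intro f g
    calc D f * D g = u * Matrix.diagonal f * (uᴴ * u) * Matrix.diagonal g * uᴴ := by
          simp only [D, Matrix.mul_assoc]
      _ = D fun i => f i * g i := by
          rw [hu, Matrix.mul_one, Matrix.mul_assoc u, Matrix.diagonal_mul_diagonal]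
  let lam : α → ℂ := fun i => (hH.eigenvalues i : ℂ)
  have hspec : B * Bᴴ = D lam := by
    conv_lhs => rw [hH.spectral_theorem, Unitary.conjStarAlgAut_apply]
    rfl
  -- the inverse of `0` is `0`, so this is the pseudo-inverse
  refine ⟨D fun i => lam i * (lam i)⁻¹, Bᴴ * D fun i => (lam i)⁻¹, ?_, ?_, ?_⟩
  · simp only [D, Matrix.conjTranspose_mul, Matrix.conjTranspose_conjTranspose,
      Matrix.diagonal_conjTranspose, Matrix.mul_assoc]
    congr 3
    ext i
    simp [lam]
  · have h1 : ((D fun i => lam i * (lam i)⁻¹) - 1) * (B * Bᴴ) = 0 := by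
      rw [hspec, sub_mul, one_mul, hD, sub_eq_zero]
      congr 1
      ext i
      by_cases h : lam i = 0 <;> simp [h]
    rw [Matrix.mul_self_mul_conjTranspose_eq_zero, Matrix.sub_mul, Matrix.one_mul,
      sub_eq_zero] at h1
    exact h1
  · rw [← Matrix.mul_assoc, hspec, hD]

theorem exists_projectionFamily {ι α β : Type*} [Fintype α] [Fintype β] {B : ι → Matrix α β ℂ}
    (hB : ∀ i j, i ≠ j → (B i)ᴴ * B j = 0) :
    ∃ T : ι → Matrix α α ℂ, IsProjectionFamily T ∧ ∀ i, T i * B i = B i := by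
  choose P C hP hPB hPC using fun i => exists_range_projection (B i)
  refine ⟨P, ⟨hP, fun i => ?_, fun i j hij => ?_⟩, hPB⟩
  · calc P i * P i = P i * B i * C i := by rw [Matrix.mul_assoc, ← hPC]
      _ = P i := by rw [hPB, ← hPC]
  · calc P i * P j = (P i)ᴴ * P j := by rw [hP]
      _ = (C i)ᴴ * ((B i)ᴴ * B j) * C j := by
        rw [hPC i, hPC j, Matrix.conjTranspose_mul]
        simp only [Matrix.mul_assoc]
      _ = 0 := by rw [hB i j hij, Matrix.mul_zero, Matrix.zero_mul]

theorem IsProjectionFamily.kronecker {ι κ α β : Type*} [Fintype α] [Fintype β]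
    {T : ι → Matrix α α ℂ} {S : κ → Matrix β β ℂ} (hT : IsProjectionFamily T)
    (hS : IsProjectionFamily S) : IsProjectionFamily fun p : ι × κ => T p.1 ⊗ₖ S p.2 := by
  refine ⟨fun p => ?_, fun p => ?_, fun p q hpq => ?_⟩
  · rw [Matrix.conjTranspose_kronecker, hT.isHermitian, hS.isHermitian]
  · rw [← Matrix.mul_kronecker_mul, hT.mul_self, hS.mul_self]
  · rw [← Matrix.mul_kronecker_mul]
    by_cases h : p.1 = q.1
    · have h' : p.2 ≠ q.2 := fun h' => hpq (Prod.ext h h')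
      rw [hS.mul_eq_zero _ _ h', Matrix.kronecker_zero]
    · rw [hT.mul_eq_zero _ _ h, Matrix.zero_kronecker]

theorem sum_kronecker_eq_one {ι κ α β : Type*} [Fintype ι] [Fintype κ]
    [DecidableEq α] [DecidableEq β] {T : ι → Matrix α α ℂ} {S : κ → Matrix β β ℂ}
    (hT : ∑ i, T i = 1) (hS : ∑ j, S j = 1) : ∑ p : ι × κ, T p.1 ⊗ₖ S p.2 = 1 := by
  rw [← Matrix.one_kronecker_one, ← hT, ← hS, Fintype.sum_prod_type]
  ext ⟨i, i'⟩ ⟨j, j'⟩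
  simp only [Matrix.sum_apply, Matrix.kronecker_apply, Finset.sum_mul_sum]

/-- If no outcome of a projective measurement, performed after an isometry, is possible for two
different states of the same group, then its Lüders instrument broadcasts the orthogonality:
the post-measurement states for different outcomes are orthogonal as well. -/
theorem ClassicallyBroadcastable.of_projectionFamily {Θ : Type*} {I : Θ → Type*} {d : ℕ}
    {s : ∀ θ, I θ → EuclideanSpace ℂ (Fin d)} {X N : Type*} [Fintype X] [Fintype N]
    [DecidableEq N] {T : X → Matrix N N ℂ} (hT : IsProjectionFamily T) (hT1 : ∑ x, T x = 1)
    {V : Matrix N (Fin d) ℂ} (hV : Vᴴ * V = 1)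
    (h : ∀ θ (i j : I θ), i ≠ j → ∀ x, T x *ᵥ (V *ᵥ (s θ i).ofLp) = 0 ∨
      T x *ᵥ (V *ᵥ (s θ j).ofLp) = 0) :
    ClassicallyBroadcastable fun θ i => ketbra (s θ i) := by
  let eX := (Fintype.equivFin X).symm
  let eN := (Fintype.equivFin N).symm
  let L : Fin (Fintype.card X) → Matrix (Fin (Fintype.card N)) (Fin d) ℂ :=
    fun x => (T (eX x) * V).submatrix eN id
  have hL : ∑ x, (L x)ᴴ * L x = 1 := by
    have h1 : ∀ x, (L x)ᴴ * L x = Vᴴ * T (eX x) * V := by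
      intro x
      simp only [L]
      rw [Matrix.conjTranspose_submatrix, Matrix.submatrix_mul_equiv, Matrix.submatrix_id_id,
        Matrix.conjTranspose_mul, hT.isHermitian, Matrix.mul_assoc, ← Matrix.mul_assoc (T _),
        hT.mul_self, Matrix.mul_assoc]
    simp only [h1]
    rw [eX.sum_comp fun x => Vᴴ * T x * V, ← Matrix.sum_mul, ← Matrix.mul_sum, hT1,
      Matrix.mul_one, hV]
  have hLv : ∀ x (v : EuclideanSpace ℂ (Fin d)),
      L x *ᵥ v.ofLp = (T (eX x) *ᵥ (V *ᵥ v.ofLp)) ∘ eN := by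
    intro x v
    rw [Matrix.mulVec_mulVec]
    rfl
  have hdot : ∀ θ (i j : I θ), i ≠ j → ∀ x y,
      star (L x *ᵥ (s θ i).ofLp) ⬝ᵥ (L y *ᵥ (s θ j).ofLp) = 0 := by
    intro θ i j hij x y
    by_cases hxy : x = y
    · subst hxy
      rcases h θ i j hij (eX x) with h0 | h0
      · rw [hLv, h0, Pi.zero_comp, star_zero, zero_dotProduct]
      · rw [hLv x (s θ j), h0, Pi.zero_comp, dotProduct_zero]
    · have : star (L x *ᵥ (s θ i).ofLp) = star (T (eX x) *ᵥ (V *ᵥ (s θ i).ofLp)) ∘ eN := by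
        rw [hLv]; rfl
      rw [this, hLv, comp_equiv_dotProduct_comp_equiv, Matrix.star_mulVec,
        ← Matrix.dotProduct_mulVec, Matrix.mulVec_mulVec, hT.isHermitian,
        hT.mul_eq_zero _ _ (eX.injective.ne hxy), Matrix.zero_mulVec, dotProduct_zero]
  refine ⟨_, _, fun x => conjMap (L x), isInstrument_conjMap hL, fun θ i j hij => ⟨?_, ?_⟩⟩
  · simp only [OrthogonalStates, traceRight_qcMap, conjMap_apply, mul_ketbra_mul]
    rw [Matrix.sum_mul, Finset.sum_eq_zero, Matrix.trace_zero]
    intro x _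
    rw [Matrix.mul_sum]
    refine Finset.sum_eq_zero fun y _ => ?_
    rw [Matrix.vecMulVec_mul_vecMulVec, hdot θ i j hij x y]
    simp
  · rw [OrthogonalStates, traceLeft_qcMap, traceLeft_qcMap, Matrix.diagonal_mul_diagonal,
      Matrix.trace_diagonal]
    refine Finset.sum_eq_zero fun x _ => ?_
    simp only [conjMap_apply, mul_ketbra_mul, hLv]
    rcases h θ i j hij (eX x) with h0 | h0
    · rw [h0]; simp
    · rw [h0]; simp

/-- Two groups of states whose outputs under an isometry into `α ⊗ β` have, within each group,
orthogonal reduced states on `α` and on `β`: a measurement on `α` identifies the states of the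
first group, and a measurement on `β`, compatible with it, those of the second. -/
theorem exists_broadcasting_measurement {I J α β : Type*} {d : ℕ} [Fintype I] [Fintype J]
    [Fintype α] [Fintype β] [DecidableEq α] [DecidableEq β] (V : Matrix (α × β) (Fin d) ℂ)
    {s : I → EuclideanSpace ℂ (Fin d)} {t : J → EuclideanSpace ℂ (Fin d)}
    (hs : ∀ i j, i ≠ j → (outMatrix V (s i))ᴴ * outMatrix V (s j) = 0)
    (ht : ∀ i j, i ≠ j → outMatrix V (t j) * (outMatrix V (t i))ᴴ = 0) :
    ∃ T : Option I × Option J → Matrix (α × β) (α × β) ℂ, IsProjectionFamily T ∧ ∑ x, T x = 1 ∧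
      (∀ i x, x.1 ≠ some i → T x *ᵥ (V *ᵥ (s i).ofLp) = 0) ∧
      (∀ j x, x.2 ≠ some j → T x *ᵥ (V *ᵥ (t j).ofLp) = 0) := by
  obtain ⟨P, hP, hPs⟩ := exists_projectionFamily hs
  have ht' : ∀ i j, i ≠ j → ((outMatrix V (t i))ᵀ)ᴴ * (outMatrix V (t j))ᵀ = 0 := by
    intro i j hij
    have h := congrArg Matrix.transpose (ht i j hij)
    rw [Matrix.transpose_mul, Matrix.transpose_zero] at h
    exact h
  obtain ⟨Q, hQ, hQt⟩ := exists_projectionFamily ht'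
  refine ⟨_, hP.completion.kronecker hQ.completion,
    sum_kronecker_eq_one (sum_completion P) (sum_completion Q), fun i x hx => ?_, fun j x hx => ?_⟩
  · rw [← ketMatrix_eq_zero, ketMatrix_kronecker_mulVec]
    change completion P x.1 * (outMatrix V (s i) * _) = 0
    rw [← Matrix.mul_assoc, ← hPs i, ← Matrix.mul_assoc]
    have h0 : completion P x.1 * P i = 0 := hP.completion.mul_eq_zero x.1 (some i) hx
    rw [h0, Matrix.zero_mul, Matrix.zero_mul]
  · rw [← ketMatrix_eq_zero, ketMatrix_kronecker_mulVec]
    change _ * (outMatrix V (t j) * (completion Q x.2)ᵀ) = 0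
    have h0 : completion Q x.2 * Q j = 0 := hQ.completion.mul_eq_zero x.2 (some j) hx
    have h1 : completion Q x.2 * (outMatrix V (t j))ᵀ = 0 := by
      rw [← hQt j, ← Matrix.mul_assoc, h0, Matrix.zero_mul]
    have h2 := congrArg Matrix.transpose h1
    rw [Matrix.transpose_mul, Matrix.transpose_transpose, Matrix.transpose_zero] at h2
    rw [h2, Matrix.mul_zero]

/-! ### Distinguishability by quantum communication implies broadcast form -/

theorem prodKet_smul_left {m d : ℕ} (c : ℂ) (a : EuclideanSpace ℂ (Fin m))
    (b : EuclideanSpace ℂ (Fin d)) : prodKet (c • a) b = prodKet a (c • b) := by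
  ext p
  simp only [prodKet, PiLp.smul_apply, smul_eq_mul]
  ring

/-- If Bob's vectors are orthonormal, every element is of the third kind. -/
theorem hasBroadcastForm_of_orthonormal {K : Type*} {d : ℕ}
    {a : K → EuclideanSpace ℂ (Fin 2)} {b : K → EuclideanSpace ℂ (Fin d)}
    (ha : ∀ k, ‖a k‖ = 1) (hb : Orthonormal ℂ b) : HasBroadcastForm a b := by
  have hempty : ∀ θ : Fin 2, IsEmpty {k : K // (none : Option (Fin 2)) = some θ} := fun θ =>
    ⟨fun i => Option.some_ne_none θ i.2.symm⟩
  refine ⟨EuclideanSpace.basisFun (Fin 2) ℂ, a, b, fun _ => none,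
    fun k => ⟨ha k, hb.1 k, rfl⟩, by simp, fun θ => ?_, ?_, fun k _ l hl => hb.2 hl.symm⟩
  · exact ⟨fun i => (hempty θ).elim i, fun i => (hempty θ).elim i⟩
  · exact ClassicallyBroadcastable.of_projectionFamily (X := Unit) (N := Fin d) (T := fun _ => 1)
      (V := 1) ⟨by simp, by simp, fun i j h => (h rfl).elim⟩ (by simp) (by simp)
      fun θ i => (hempty θ).elim i

/-- The cross terms of `(x A + x' A')ᴴ (y A + y' A')` vanish when `A` and `A'` have orthogonal ranges
and orthogonal row spaces, and multiplication by `A` then isolates the term with `A`. -/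
theorem mul_eq_zero_of_conjTranspose_mul_eq_zero {α β : Type*} [Fintype α] [Fintype β]
    {A A' : Matrix α β ℂ} (hA : A ≠ 0) (hAA' : A * A'ᴴ = 0) (h : Aᴴ * A' = 0) {x x' y y' : ℂ}
    (hxy : (x • A + x' • A')ᴴ * (y • A + y' • A') = 0) : x * y = 0 := by
  have h' : A'ᴴ * A = 0 := by
    have := congrArg Matrix.conjTranspose h
    rwa [Matrix.conjTranspose_mul, Matrix.conjTranspose_conjTranspose,
      Matrix.conjTranspose_zero] at this
  have h1 : A * ((x • A + x' • A')ᴴ * (y • A + y' • A')) = (star x * y) • (A * (Aᴴ * A)) := by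
    simp only [Matrix.conjTranspose_add, Matrix.conjTranspose_smul, Matrix.add_mul,
      Matrix.mul_add, Matrix.smul_mul, Matrix.mul_smul, h, h', smul_zero, Matrix.mul_zero]
    rw [← Matrix.mul_assoc A A'ᴴ A', hAA']
    simp [smul_smul, mul_comm]
  rw [hxy, Matrix.mul_zero] at h1
  have h2 : A * (Aᴴ * A) ≠ 0 := by
    rw [← Matrix.mul_assoc]
    intro h0
    rw [Matrix.self_mul_conjTranspose_mul_eq_zero, Matrix.conjTranspose_mul_self_eq_zero] at h0
    exact hA h0
  have h3 := (smul_eq_zero.mp h1.symm).resolve_right h2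
  simpa using h3

open Classical in
/-- The kind of an element with Alice's ket `v`: `some θ` if `v` is a multiple of `e θ`. -/
noncomputable def basisLabel (e : OrthonormalBasis (Fin 2) ℂ (EuclideanSpace ℂ (Fin 2)))
    (v : EuclideanSpace ℂ (Fin 2)) : Option (Fin 2) :=
  if inner ℂ (e 1) v = 0 then some 0 else if inner ℂ (e 0) v = 0 then some 1 else none

theorem eq_smul_of_basisLabel {e : OrthonormalBasis (Fin 2) ℂ (EuclideanSpace ℂ (Fin 2))}
    {v : EuclideanSpace ℂ (Fin 2)} {θ : Fin 2} (h : basisLabel e v = some θ) :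
    v = inner ℂ (e θ) v • e θ := by
  have hv := e.sum_repr' v
  rw [Fin.sum_univ_two] at hv
  unfold basisLabel at h
  split_ifs at h with h1 h0
  · obtain rfl : 0 = θ := Option.some_injective _ h
    simpa [h1] using hv.symm
  · obtain rfl : 1 = θ := Option.some_injective _ h
    simpa [h0] using hv.symm

/-- Vectors whose coordinates have disjoint supports are multiples of different basis vectors. -/
theorem basisLabel_of_mul_eq_zero {e : OrthonormalBasis (Fin 2) ℂ (EuclideanSpace ℂ (Fin 2))}
    {v w : EuclideanSpace ℂ (Fin 2)} (hv : v ≠ 0) (hw : w ≠ 0)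
    (h : ∀ θ, inner ℂ (e θ) v * inner ℂ (e θ) w = 0) :
    basisLabel e v ≠ none ∧ basisLabel e v ≠ basisLabel e w := by
  have hne : ∀ u : EuclideanSpace ℂ (Fin 2), u ≠ 0 →
      inner ℂ (e 0) u ≠ 0 ∨ inner ℂ (e 1) u ≠ 0 := by
    intro u hu
    by_contra! h'
    apply hu
    rw [← e.sum_repr' u, Fin.sum_univ_two, h'.1, h'.2]
    simp
  have h0 := mul_eq_zero.mp (h 0)
  have h1 := mul_eq_zero.mp (h 1)
  have hv' := hne v hv
  have hw' := hne w hw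
  unfold basisLabel
  by_cases a1 : inner ℂ (e 1) v = 0 <;> by_cases a0 : inner ℂ (e 0) v = 0 <;>
    by_cases b1 : inner ℂ (e 1) w = 0 <;> by_cases b0 : inner ℂ (e 0) w = 0 <;> simp_all

/-- Two of Bob's vectors that are not orthogonal force Alice's isometry to copy the basis `e` of
the corresponding kets. Alice's reduced states are then orthogonal only for kets proportional to
different basis vectors, so for all other pairs Bob's reduced states are orthogonal. -/
theorem exists_basis_of_inner_ne_zero {K : Type*} {d : ℕ}
    {a : K → EuclideanSpace ℂ (Fin 2)} {b : K → EuclideanSpace ℂ (Fin d)}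
    (ha : ∀ k, ‖a k‖ = 1) {α α' β β' : Type*} [Fintype α] [Fintype α'] [Fintype β] [Fintype β']
    {U : Matrix (α × β') (Fin 2) ℂ} {V : Matrix (β × α') (Fin d) ℂ} (hU : Uᴴ * U = 1)
    (hV : Vᴴ * V = 1)
    (hUV : ∀ i j, i ≠ j →
      ((outMatrix U (a i))ᴴ * outMatrix U (a j) = 0 ∨
        outMatrix V (b j) * (outMatrix V (b i))ᴴ = 0) ∧
      (outMatrix U (a j) * (outMatrix U (a i))ᴴ = 0 ∨
        (outMatrix V (b i))ᴴ * outMatrix V (b j) = 0))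
    {k l : K} (hkl : k ≠ l) (hb : inner ℂ (b k) (b l) ≠ 0) :
    ∃ e : OrthonormalBasis (Fin 2) ℂ (EuclideanSpace ℂ (Fin 2)), ∀ i j, i ≠ j →
      (basisLabel e (a i) = none ∨ basisLabel e (a i) = basisLabel e (a j)) →
      (outMatrix V (b i))ᴴ * outMatrix V (b j) = 0 ∧
        outMatrix V (b j) * (outMatrix V (b i))ᴴ = 0 := by
  have hA1 := (hUV k l hkl).1.resolve_right fun h => hb (inner_eq_zero_of_mul_conjTranspose hV h)
  have hA2 := (hUV k l hkl).2.resolve_right fun h => hb (inner_eq_zero_of_conjTranspose_mul hV h)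
  have hakl : inner ℂ (a k) (a l) = 0 := inner_eq_zero_of_conjTranspose_mul hU hA1
  have hon : Orthonormal ℂ ![a k, a l] := by
    refine ⟨fun i => ?_, fun i j hij => ?_⟩
    · fin_cases i <;> simp [ha]
    · fin_cases i <;> fin_cases j
      · exact absurd rfl hij
      · exact hakl
      · exact inner_eq_zero_symm.mp hakl
      · exact absurd rfl hij
  obtain ⟨e, he⟩ : ∃ e : OrthonormalBasis (Fin 2) ℂ (EuclideanSpace ℂ (Fin 2)),
      e 0 = a k ∧ e 1 = a l := by
    obtain ⟨e, he⟩ := Orthonormal.exists_orthonormalBasis_extension_of_card_eq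
      (𝕜 := ℂ) (v := ![a k, a l]) (s := Set.univ) (by simp) (hon.comp _ Subtype.val_injective)
    exact ⟨e, he 0 trivial, he 1 trivial⟩
  rw [← he.1, ← he.2] at hA1 hA2
  have ha0 : ∀ i, a i ≠ 0 := fun i h => by simpa [h] using ha i
  have hAne : ∀ θ, outMatrix U (e θ) ≠ 0 := by
    intro θ h
    have h1 := trace_outMatrix hU (e θ) (e θ)
    rw [h, inner_self_eq_norm_sq_to_K, e.orthonormal.1 θ] at h1
    simp at h1
  have hexp : ∀ v, outMatrix U v = inner ℂ (e 0) v • outMatrix U (e 0) +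
      inner ℂ (e 1) v • outMatrix U (e 1) := by
    intro v
    rw [← outMatrix_smul, ← outMatrix_smul, ← outMatrix_add]
    congr 1
    rw [← Fin.sum_univ_two fun i => inner ℂ (e i) v • e i, e.sum_repr' v]
  have hA1' : (outMatrix U (e 1))ᴴ * outMatrix U (e 0) = 0 := by
    simpa using congrArg Matrix.conjTranspose hA1
  have hA2' : outMatrix U (e 0) * (outMatrix U (e 1))ᴴ = 0 := by
    simpa using congrArg Matrix.conjTranspose hA2
  have hdisj1 : ∀ v w, (outMatrix U v)ᴴ * outMatrix U w = 0 →
      ∀ θ, inner ℂ (e θ) v * inner ℂ (e θ) w = 0 := by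
    intro v w h θ
    rw [hexp v, hexp w] at h
    fin_cases θ
    · exact mul_eq_zero_of_conjTranspose_mul_eq_zero (hAne 0) hA2' hA1 h
    · rw [add_comm, add_comm (_ • outMatrix U (e 0))] at h
      exact mul_eq_zero_of_conjTranspose_mul_eq_zero (hAne 1) hA2 hA1' h
  have hdisj2 : ∀ v w, outMatrix U w * (outMatrix U v)ᴴ = 0 →
      ∀ θ, inner ℂ (e θ) v * inner ℂ (e θ) w = 0 := by
    intro v w h θ
    have hAne' : ∀ θ, (outMatrix U (e θ))ᴴ ≠ 0 := fun θ h =>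
      hAne θ (Matrix.conjTranspose_eq_zero.mp h)
    have hexp' : ∀ v, (outMatrix U v)ᴴ = star (inner ℂ (e 0) v) • (outMatrix U (e 0))ᴴ +
        star (inner ℂ (e 1) v) • (outMatrix U (e 1))ᴴ := fun v => by
      rw [hexp v, Matrix.conjTranspose_add, Matrix.conjTranspose_smul, Matrix.conjTranspose_smul]
    rw [← Matrix.conjTranspose_conjTranspose (outMatrix U w), hexp' v, hexp' w] at h
    have h' : star (inner ℂ (e θ) w) * star (inner ℂ (e θ) v) = 0 := by
      fin_cases θ
      · exact mul_eq_zero_of_conjTranspose_mul_eq_zero (hAne' 0) (by simpa using hA1)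
          (by simpa using hA2') h
      · rw [add_comm, add_comm (_ • (outMatrix U (e 0))ᴴ)] at h
        exact mul_eq_zero_of_conjTranspose_mul_eq_zero (hAne' 1) (by simpa using hA1')
          (by simpa using hA2) h
    rw [← star_mul', star_eq_zero, mul_comm] at h'
    exact h'
  refine ⟨e, fun i j hij hlab => ?_⟩
  have hno : ¬ ∀ θ, inner ℂ (e θ) (a i) * inner ℂ (e θ) (a j) = 0 := fun h => by
    have := basisLabel_of_mul_eq_zero (ha0 i) (ha0 j) h
    exact hlab.elim this.1 this.2
  exact ⟨(hUV i j hij).2.resolve_left fun h => hno (hdisj2 _ _ h),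
    (hUV i j hij).1.resolve_left fun h => hno (hdisj1 _ _ h)⟩

theorem LOSQCDistinguishable.hasBroadcastForm {K : Type*} [Fintype K] {d : ℕ}
    {a : K → EuclideanSpace ℂ (Fin 2)} {b : K → EuclideanSpace ℂ (Fin d)}
    (ha : ∀ k, ‖a k‖ = 1) (hb : ∀ k, ‖b k‖ = 1) (h : LOSQCDistinguishable a b) :
    HasBroadcastForm a b := by
  classical
  by_cases horth : ∀ k l, k ≠ l → inner ℂ (b k) (b l) = 0
  · exact hasBroadcastForm_of_orthonormal ha ⟨hb, fun k l hkl => horth k l hkl⟩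
  push Not at horth
  obtain ⟨k₀, l₀, hkl, hne⟩ := horth
  obtain ⟨n, n', l, l', U, V, hU, hV, hUV⟩ := h.exists_isometries ha hb
  obtain ⟨e, he⟩ := exists_basis_of_inner_ne_zero ha hU hV hUV hkl hne
  let label : K → Option (Fin 2) := fun k => basisLabel e (a k)
  let c : K → ℂ := fun k => (label k).elim 1 fun θ => inner ℂ (e θ) (a k)
  let α : K → EuclideanSpace ℂ (Fin 2) := fun k => (label k).elim (a k) fun θ => e θ
  have hα : ∀ k, a k = c k • α k := by
    intro k
    rcases hk : label k with _ | θ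
    · simp [c, α, hk]
    · simp only [c, α, hk, Option.elim_some]
      exact eq_smul_of_basisLabel hk
  have hα1 : ∀ k, ‖α k‖ = 1 := by
    intro k
    rcases hk : label k with _ | θ
    · simp [α, hk, ha]
    · simp [α, hk]
  have hc : ∀ k, ‖c k‖ = 1 := by
    intro k
    have := ha k
    rwa [hα k, norm_smul, hα1, mul_one] at this
  have hβ1 : ∀ k, ‖c k • b k‖ = 1 := fun k => by rw [norm_smul, hc, hb, mul_one]
  have horth : ∀ i j, i ≠ j → (label i = none ∨ label i = label j) →
      inner ℂ (c i • b i) (c j • b j) = 0 := by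
    intro i j hij hlab
    rw [inner_smul_left, inner_smul_right,
      inner_eq_zero_of_conjTranspose_mul hV (he i j hij hlab).1]
    simp
  have hB : ∀ i j, i ≠ j → label i = label j →
      (outMatrix V (c i • b i))ᴴ * outMatrix V (c j • b j) = 0 ∧
        outMatrix V (c j • b j) * (outMatrix V (c i • b i))ᴴ = 0 := by
    intro i j hij hlab
    have := he i j hij (Or.inr hlab)
    simp [outMatrix_smul, this.1, this.2]
  refine ⟨e, α, fun k => c k • b k, label, fun k => ⟨hα1 k, hβ1 k, ?_⟩, ?_, ?_, ?_, ?_⟩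
  · rw [← prodKet_smul_left, ← hα]
  · intro k θ hk
    simp [α, hk]
  · intro θ
    exact ⟨fun i => hβ1 i, fun i j hij =>
      horth i j (fun h => hij (Subtype.ext h)) (Or.inr (i.2.trans j.2.symm))⟩
  · obtain ⟨T, hT, hT1, hs, ht⟩ := exists_broadcasting_measurement V
      (s := fun i : {k // label k = some 0} => c i • b i)
      (t := fun i : {k // label k = some 1} => c i • b i)
      (fun i j hij => (hB i j (fun h => hij (Subtype.ext h)) (i.2.trans j.2.symm)).1)
      (fun i j hij => (hB i j (fun h => hij (Subtype.ext h)) (i.2.trans j.2.symm)).2)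
    refine ClassicallyBroadcastable.of_projectionFamily hT hT1 hV fun θ => ?_
    fin_cases θ
    · intro i j hij x
      by_cases hx : x.1 = some i
      · exact Or.inr (hs j x fun h => hij (Option.some_injective _ (hx.symm.trans h)))
      · exact Or.inl (hs i x hx)
    · intro i j hij x
      by_cases hx : x.2 = some i
      · exact Or.inr (ht j x fun h => hij (Option.some_injective _ (hx.symm.trans h)))
      · exact Or.inl (ht i x hx)
  · exact fun k hk l hl => horth k l hl.symm (Or.inl hk)

/-- A measurement without outcomes exists only on the zero space. If there is nothing to distinguish,
the register `A₁` sent to Alice is therefore zero-dimensional, since her own `A₀` is not; then so is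
Bob's input space, and the instrument with no outcomes is a valid choice for Bob. -/
theorem LOSQCDistinguishable.losccDistinguishable_of_isEmpty {K : Type*} [Fintype K] [IsEmpty K]
    {d : ℕ} {a : K → EuclideanSpace ℂ (Fin 2)} {b : K → EuclideanSpace ℂ (Fin d)}
    (h : LOSQCDistinguishable a b) : LOSCCDistinguishable a b := by
  obtain ⟨S, -⟩ := h
  have hA : IsEmpty (Fin S.dimA₀ × Fin S.dimA₁) := by
    by_contra hne
    rw [not_isEmpty_iff] at hne
    have := S.povmA_isPOVM.sum_eq_one
    simp at this
  have hd : IsEmpty (Fin d) := by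
    rcases isEmpty_prod.mp hA with h0 | h0
    · have := S.U_isometry
      have h1 : S.Uᴴ * S.U = 0 := by
        ext i j
        simp [Matrix.mul_apply]
      rw [h1] at this
      simp at this
    · by_contra hne
      rw [not_isEmpty_iff] at hne
      have := S.V_isometry
      have h1 : S.Vᴴ * S.V = 0 := by
        ext i j
        simp [Matrix.mul_apply]
      rw [h1] at this
      simp at this
  refine ⟨⟨2, 0, 1, 0, fun _ => conjMap 1, Fin.elim0, isInstrument_conjMap (by simp),
    ⟨fun y => y.elim0, fun ρ => ?_⟩, fun _ y => y.elim0, fun _ y => y.elim0,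
    fun _ y => y.elim0, fun _ y => y.elim0⟩, fun k => isEmptyElim k⟩
  simp

end LocalDiscrimination

theorem mainTheorem6 {K : Type*} [Fintype K] {d : ℕ}
    (a : K → EuclideanSpace ℂ (Fin 2)) (b : K → EuclideanSpace ℂ (Fin d))
    (h : LocalDiscrimination.IsGOP a b) :
    (LocalDiscrimination.LOSCCDistinguishable a b ↔
        LocalDiscrimination.LOSQCDistinguishable a b) ∧
      (LocalDiscrimination.LOSCCDistinguishable a b ∨
          LocalDiscrimination.LOSQCDistinguishable a b →
        LocalDiscrimination.HasBroadcastForm a b) := by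
  have hform : LocalDiscrimination.LOSQCDistinguishable a b →
      LocalDiscrimination.HasBroadcastForm a b := fun hq =>
    hq.hasBroadcastForm h.norm_left h.norm_right
  refine ⟨⟨fun hc => hc.losqcDistinguishable, fun hq => ?_⟩,
    fun hcq => hform (hcq.elim (fun hc => hc.losqcDistinguishable) id)⟩
  rcases isEmpty_or_nonempty K with hK | hK
  · exact hq.losccDistinguishable_of_isEmpty
  · exact (hform hq).losccDistinguishable h.norm_left h.norm_right
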